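/- **Theorem 5.3 (Main Theorem).** *Notation.* Points of $\mathbb R\times\mathbb R^3$ are $\vec x=(x_0,x)=(x_0,x_1,x_2,x_3)$; $\pi_0(\vec x)=x$; $I=[0,1]$; $\hat x_1=(x_2,x_3)$, $\hat x_2=(x_1,x_3)$, $\hat x_3=(x_1,x_2)$. A *loop* is an oriented $C^1$ simple closed curve in $\mathbb R\times\mathbb R^3$ with a regular $1$-periodic parametrization. A finite set of disjoint loops is a *time-like hyperlink* if any two distinct points $\vec x,\vec z$ of its union satisfy $x\ne z$, and $x_0\neq z_0$ whenever two of the three spatial coordinates of $\vec x$ and $\vec z$ agree. *Hyperlinks.* Let $\bar L=\{\bar l^u\}_{u=1}^{\bar n}$ ($\bar n\ge1$) and $\underline L=\{\underline l^v\}_{v=1}^{\underline n}$ be hyperlinks with parametrizations $\vec y^u=(y^u_0,y^u)$, $\vec\varrho^v=(\varrho^v_0,\varrho^v)$, which together form a time-like hyperlink. For $k=1,2,3$ a *crossing* of $\bar l^u$ and $\underline l^v$ in the $k$-th diagram is a pair $(s,t)\in[0,1)^2$ with $\hat y^u_k(s)=\hat\varrho^v_k(t)$; assume that $[y^{u\prime}(s)\times\varrho^{v\prime}(t)]_k\neq0$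 at every crossing. Put $$\mathrm{sk}(\bar l^u,\underline L)=\sum_{v=1}^{\underline n}\sum_{k=1}^3\ \sum_{(s,t)\text{ crossing}}\mathrm{sgn}[y^{u\prime}(s)\times\varrho^{v\prime}(t)]_k\cdot\mathrm{sgn}(y^u_k(s)-\varrho^v_k(t))\cdot\mathrm{sgn}(\varrho^v_0(t)-y^u_0(s)).$$ *Colors.* Each $\bar l^u$ is colored by a pair $\rho_u=(\rho_u^+,\rho_u^-)$ of irreducible finite dimensional complex representations of $\mathfrak{su}(2)$. For such a $\rho$ of dimension $2j+1$ let $\xi_\rho=j(j+1)$. Let $\mathcal E^\pm=\breve e_1+\breve e_2+\breve e_3\in\mathfrak{su}(2)$, where $\breve e_1=\frac12\begin{pmatrix}0&1\\-1&0\end{pmatrix}$, $\breve e_2=\frac12\begin{pmatrix}0&i\\i&0\end{pmatrix}$, $\breve e_3=\frac12\begin{pmatrix}i&0\\0&-i\end{pmatrix}$, and $\mathrm{Tr}_\rho\exp[a\mathcal E^\pm]=\mathrm{Tr}\exp[a\rho(\mathcal E^\pm)]$ for $a\in\mathbb C$. Let $\gamma_1,\dots,\gamma_{\bar m}$ be the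 distinct ones (up to equivalence) among the $\rho_u$ and $\Gamma_v=\{u:\rho_u\cong\gamma_v\}$. *Surface.* Let $S\subset\{0\}\times\mathbb R^3$ be a compact surface in the plane $\{x_0=x_1=0\}$ with a parametrization $\vec\sigma:I^2\to S$ that is onto and, off a closed-in-$I^2$ exceptional set that is of measure zero and has image of measure zero (edges and seams), is $C^1$ and injective with $J_{23}=\partial_t\sigma_2\,\partial_{\bar t}\sigma_3-\partial_{\bar t}\sigma_2\,\partial_t\sigma_3>0$. Assume that $\bar L\cap S=\emptyset$, that the set of *piercings* $\mathrm{Pd}(\pi_0;\bar l^u,S)=\pi_0(\bar l^u)\cap\pi_0(S)$ is finite for each $u$, and that $y^{u\prime}_1\ne0$ at every piercing. Let $I^2=\bigsqcup_{v=1}^{\bar m}I^2_v$ be a measurable partition such that for every $v$ the loops $\bar l^u$, $u\in\Gamma_v$, pierce $S$ only in the interior (relative to the plane) of $S_v=\vec\sigma(I_v^2)$. *Regularization.* For $x\in\mathbb R^n$ let $p_\kappa^x(z)=(\kappa/\sqrt{2\pi})^{n/2}e^{-\kappa^2|z-x|^2/4}$, and write $q_\kappa^x$ for $p_\kappa^x$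 when $n=1$. Let $\langle f,g\rangle=\int fg$ (Lebesgue measure), $(\partial^{-1}f)(t)=\frac12\int_{-\infty}^tf-\frac12\int_t^\infty f$ for functions on $\mathbb R$, and $\partial_0^{-1}$ the same operation in the variable $x_0$ for functions on $\mathbb R^4$. Let $\bar\kappa=\kappa/(2\sqrt{4\pi})$, $$\langle p_\kappa^{\vec x},p_\kappa^{\vec z}\rangle_k=\langle p_\kappa^{\hat x_k},p_\kappa^{\hat z_k}\rangle\,\langle q_\kappa^{x_k},\kappa\partial^{-1}q_\kappa^{z_k}\rangle\,\langle\partial^{-1}q_\kappa^{x_0},q_\kappa^{z_0}\rangle,$$ $$\hat{\mathcal W}^\pm_\kappa(q;\bar l^u,\underline L)=\exp\Big[\mp\frac{iq}4\frac{\kappa^3}{4\pi}\sum_{v=1}^{\underline n}\int_{I^2}\sum_{i,j,k=1}^3\epsilon^{ijk}\langle p_\kappa^{\vec y^u_s},p_\kappa^{\vec\varrho^v_{\bar s}}\rangle_k\,y^{u\prime}_{i,s}\varrho^{v\prime}_{j,\bar s}\,ds\,d\bar s\;\mathcal E^\pm\Big],$$ $$B_\kappa^\pm=\sum_{v=1}^{\bar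 m}\bar\kappa^3\int_{I_v^2}\Big|\Big\langle q\sum_{u\in\Gamma_v}\kappa\int_0^1y^{u\prime}_{1,s}\,\partial_0^{-1}p_\kappa^{\vec y^u_s}\,ds,\;p_\kappa^{\vec\sigma(\hat t)}\Big\rangle\sqrt{\xi_{\gamma_v^\pm}}\Big|\,J_{23}(\hat t)\,d\hat t .$$ *Claim.* For every charge $q\in\mathbb R$, the area operator applied to the Wilson loop observable, $\hat A_S[Z(q;\chi(\bar L,\underline L))]$, defined as $$\lim_{\kappa\to\infty}\prod_{\bar u=1}^{\bar n}\Big\{[B_\kappa^+]^{1/\bar n}\,\mathrm{Tr}_{\rho_{\bar u}^+}\hat{\mathcal W}_\kappa^+(q;\bar l^{\bar u},\underline L)+[iB_\kappa^-]^{1/\bar n}\,\mathrm{Tr}_{\rho_{\bar u}^-}\hat{\mathcal W}_\kappa^-(q;\bar l^{\bar u},\underline L)\Big\}$$ (principal powers), exists and equals $$\frac{|q|\sqrt\pi}2\prod_{\bar u=1}^{\bar n}\Big\{\Big[\sum_{u=1}^{\bar n}|\mathrm{Pd}(\pi_0;\bar l^u,S)|\sqrt{\xi_{\rho_u^+}}\Big]^{1/\bar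 n}\mathrm{Tr}_{\rho^+_{\bar u}}\exp[-\pi iq\,\mathrm{sk}(\bar l^{\bar u},\underline L)\,\mathcal E^+]+\Big[i\sum_{u=1}^{\bar n}|\mathrm{Pd}(\pi_0;\bar l^u,S)|\sqrt{\xi_{\rho_u^-}}\Big]^{1/\bar n}\mathrm{Tr}_{\rho^-_{\bar u}}\exp[\pi iq\,\mathrm{sk}(\bar l^{\bar u},\underline L)\,\mathcal E^-]\Big\}.$$ In particular the limit does not depend on the partition or on the parametrization of $S$. -/

import Mathlib

open Filter Topology MeasureTheory

noncomputable section

namespace AreaLQG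

attribute [local instance 100] LieRing.ofAssociativeRing

/-! ### Irreducible representations of `su(2)` -/

/-- The real Lie algebra `su(2)` of traceless skew-Hermitian `2 × 2` matrices. -/
def su2 : LieSubalgebra ℝ (Matrix (Fin 2) (Fin 2) ℂ) where
  carrier := {A | A.conjTranspose = -A ∧ A.trace = 0}
  zero_mem' := by simp
  add_mem' := by
    rintro A B ⟨hA, tA⟩ ⟨hB, tB⟩
    refine ⟨?_, ?_⟩
    · rw [Matrix.conjTranspose_add, hA, hB]; abel
    · rw [Matrix.trace_add, tA, tB, add_zero]
  smul_mem' := by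
    rintro c A ⟨hA, tA⟩
    refine ⟨?_, ?_⟩
    · rw [Matrix.conjTranspose_smul, hA, star_trivial, smul_neg]
    · rw [Matrix.trace_smul, tA, smul_zero]
  lie_mem' := by
    rintro A B ⟨hA, tA⟩ ⟨hB, tB⟩
    refine ⟨?_, ?_⟩
    · rw [Ring.lie_def, Matrix.conjTranspose_sub, Matrix.conjTranspose_mul,
        Matrix.conjTranspose_mul, hA, hB]
      noncomm_ring
    · rw [Ring.lie_def, Matrix.trace_sub, Matrix.trace_mul_comm, sub_self]

/-- The basis element `(1/2) [[0, 1], [-1, 0]]`. -/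
def e₁ : su2 := ⟨(1 / 2 : ℂ) • !![0, 1; -1, 0], by
  constructor
  · ext i j; fin_cases i <;> fin_cases j <;> simp
  · simp [Matrix.trace_fin_two]⟩

/-- The basis element `(1/2) [[0, i], [i, 0]]`. -/
def e₂ : su2 := ⟨(1 / 2 : ℂ) • !![0, Complex.I; Complex.I, 0], by
  constructor
  · ext i j; fin_cases i <;> fin_cases j <;> simp
  · simp [Matrix.trace_fin_two]⟩

/-- The basis element `(1/2) [[i, 0], [0, -i]]`. -/
def e₃ : su2 := ⟨(1 / 2 : ℂ) • !![Complex.I, 0; 0, -Complex.I], by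
  constructor
  · ext i j; fin_cases i <;> fin_cases j <;> simp
  · simp [Matrix.trace_fin_two]⟩

/-- `𝓔⁺ = 𝓔⁻ = e₁ + e₂ + e₃`. -/
def calE : su2 := e₁ + e₂ + e₃

/-- An irreducible finite dimensional complex representation of `su(2)`, on `ℂ ^ dim`. -/
structure SU2Irrep where
  dim : ℕ
  toHom : su2 →ₗ⁅ℝ⁆ Matrix (Fin dim) (Fin dim) ℂ
  dim_pos : 0 < dim
  irreducible : ∀ W : Submodule ℂ (Fin dim → ℂ),
    (∀ X : su2, ∀ w ∈ W, (toHom X).mulVec w ∈ W) → W = ⊥ ∨ W = ⊤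

namespace SU2Irrep

/-- The spin `j`, given by `dim = 2 j + 1`. -/
def spin (ρ : SU2Irrep) : ℝ := ((ρ.dim : ℝ) - 1) / 2

/-- `ξ_ρ = j (j + 1)`. -/
def xi (ρ : SU2Irrep) : ℝ := ρ.spin * (ρ.spin + 1)

/-- `Tr_ρ exp[a 𝓔] = Tr exp[a ρ(𝓔)]` for `a ∈ ℂ`. -/
def trExp (ρ : SU2Irrep) (a : ℂ) : ℂ := (NormedSpace.exp (a • ρ.toHom calE)).trace

/-- Equivalence of representations, through an invertible intertwiner. -/
def Equivalent (ρ τ : SU2Irrep) : Prop :=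
  ∃ f : (Fin ρ.dim → ℂ) ≃ₗ[ℂ] (Fin τ.dim → ℂ),
    ∀ (X : su2) (w : Fin ρ.dim → ℂ), f ((ρ.toHom X).mulVec w) = (τ.toHom X).mulVec (f w)

end SU2Irrep

/-- A color `(ρ⁺, ρ⁻)`, i.e. a representation of `su(2) × su(2)` into `End V⁺ × End V⁻`. -/
structure Color where
  plus : SU2Irrep
  minus : SU2Irrep

/-- Two colors are the same representation of `su(2) × su(2)`, up to equivalence. -/
def Color.Same (ρ τ : Color) : Prop :=
  ρ.plus.Equivalent τ.plus ∧ ρ.minus.Equivalent τ.minus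

/-- `γ` lists, without repetition, the distinct representations occurring in `ρ`. -/
def ListsDistinct {n m : ℕ} (γ : Fin m → Color) (ρ : Fin n → Color) : Prop :=
  (∀ u, ∃ v, (ρ u).Same (γ v)) ∧ (∀ v, ∃ u, (ρ u).Same (γ v)) ∧
    ∀ v w, v ≠ w → ¬ (γ v).Same (γ w)

open Classical in
/-- `Γ_v`, the set of the indices `u` with `ρ_u = γ_v`. -/
def Gam {n m : ℕ} (ρ : Fin n → Color) (γ : Fin m → Color) (v : Fin m) : Finset (Fin n) :=
  Finset.univ.filter fun u => (ρ u).Same (γ v)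

/-! ### Hyperlinks in `ℝ × ℝ³`; coordinate `0` is time -/

/-- An oriented `C¹` simple closed curve in `ℝ⁴`, with a regular parametrization by `ℝ / ℤ`. -/
structure Loop where
  toFun : ℝ → Fin 4 → ℝ
  contDiff : ContDiff ℝ 1 toFun
  periodic : Function.Periodic toFun 1
  injOn : Set.InjOn toFun (Set.Ico 0 1)
  deriv_ne : ∀ s, deriv toFun s ≠ 0

instance : CoeFun Loop (fun _ => ℝ → Fin 4 → ℝ) := ⟨Loop.toFun⟩

/-- The curve as a subset of `ℝ⁴`. -/
def Loop.carrier (l : Loop) : Set (Fin 4 → ℝ) := Set.range l.toFun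

/-- The time-like condition on a subset of `ℝ⁴`. -/
def IsTimeLike (L : Set (Fin 4 → ℝ)) : Prop :=
  ∀ p ∈ L, ∀ q ∈ L, p ≠ q →
    0 < ∑ i : Fin 3, (p i.succ - q i.succ) ^ 2 ∧
    ((∃ i j : Fin 3, i ≠ j ∧ p i.succ = q i.succ ∧ p j.succ = q j.succ) → p 0 - q 0 ≠ 0)

/-- A family of pairwise disjoint loops whose union is time-like. -/
def IsTimeLikeHyperlink {ι : Type*} (L : ι → Loop) : Prop :=
  (∀ i j, i ≠ j → Disjoint (L i).carrier (L j).carrier) ∧ IsTimeLike (⋃ i, (L i).carrier)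

/-- The projection `π₀ : ℝ × ℝ³ → ℝ³`. -/
def proj0 (x : Fin 4 → ℝ) : Fin 3 → ℝ := fun i => x i.succ

/-- `x̂_k` for `k = 1, 2, 3` (the index `k : Fin 3` stands for the coordinate `k + 1`). -/
def hat (k : Fin 3) (x : Fin 4 → ℝ) : Fin 2 → ℝ :=
  ![![x 2, x 3], ![x 1, x 3], ![x 1, x 2]] k

/-- The `k`-th component of the vector product of the spatial parts of `a` and `b`. -/
def cross (k : Fin 3) (a b : Fin 4 → ℝ) : ℝ :=
  ![a 2 * b 3 - a 3 * b 2, a 3 * b 1 - a 1 * b 3, a 1 * b 2 - a 2 * b 1] k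

/-- The crossings of two loops in the link diagram on the plane `Σ_k`, each recorded by the
pair of parameters at which the two projected loops meet. -/
def crossings (k : Fin 3) (l g : Loop) : Set (ℝ × ℝ) :=
  {p | p.1 ∈ Set.Ico (0 : ℝ) 1 ∧ p.2 ∈ Set.Ico (0 : ℝ) 1 ∧ hat k (l p.1) = hat k (g p.2)}

/-- At each crossing the two projected arcs are linearly independent. -/
def CrossTransversally (l g : Loop) : Prop :=
  ∀ k, ∀ p ∈ crossings k l g, cross k (deriv l.toFun p.1) (deriv g.toFun p.2) ≠ 0

/-- Orientation times height times time-lag of a crossing. -/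
def crossingSign (k : Fin 3) (l g : Loop) (p : ℝ × ℝ) : ℤ :=
  (SignType.sign (cross k (deriv l.toFun p.1) (deriv g.toFun p.2)) : ℤ) *
    (SignType.sign (l p.1 k.succ - g p.2 k.succ) : ℤ) *
    (SignType.sign (g p.2 0 - l p.1 0) : ℤ)

/-- The hyperlinking number `sk` of two loops. -/
def sk (l g : Loop) : ℤ := ∑ k : Fin 3, ∑ᶠ p ∈ crossings k l g, crossingSign k l g p

/-- The hyperlinking number of a loop with a hyperlink. -/
def skTotal {n : ℕ} (l : Loop) (G : Fin n → Loop) : ℤ := ∑ v, sk l (G v)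

/-! ### Surfaces in the `x₂`-`x₃` plane of `{0} × ℝ³` -/

/-- `I² = [0, 1]²`. -/
def unitSquare : Set (ℝ × ℝ) := Set.Icc 0 1 ×ˢ Set.Icc 0 1

/-- `J_{αβ} = ∂_t σ_α ∂_t̄ σ_β - ∂_t̄ σ_α ∂_t σ_β`. -/
def jac (σ : ℝ × ℝ → Fin 4 → ℝ) (α β : Fin 4) (t : ℝ × ℝ) : ℝ :=
  fderiv ℝ σ t (1, 0) α * fderiv ℝ σ t (0, 1) β - fderiv ℝ σ t (0, 1) α * fderiv ℝ σ t (1, 0) β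

/-- `σ : I² → S` is a positively oriented parametrization of the surface `S`, which lies in the
`x₂`-`x₃` plane `{x₀ = x₁ = 0}`.  It is onto, and it is a regular injective `C¹` map off an
exceptional set of measure zero with image of measure zero: the edges of `I²`, and the seams
that a surface that is not a disc, or not connected, makes necessary. -/
structure Parametrizes (σ : ℝ × ℝ → Fin 4 → ℝ) (S : Set (Fin 4 → ℝ)) : Prop where
  image_eq : σ '' unitSquare = S
  planar : ∀ x ∈ S, x 0 = 0 ∧ x 1 = 0
  regular : ∃ U : Set (ℝ × ℝ), IsOpen U ∧ U ⊆ unitSquare ∧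
    volume (unitSquare \ U) = 0 ∧
    volume ((fun t => (σ t 2, σ t 3)) '' (unitSquare \ U)) = 0 ∧
    ContDiffOn ℝ 1 σ U ∧ Set.InjOn σ U ∧ ∀ t ∈ U, 0 < jac σ 2 3 t

/-- The interior of a subset of the `x₂`-`x₃` plane, relative to that plane. -/
def planeInterior (S : Set (Fin 4 → ℝ)) : Set (ℝ × ℝ) :=
  interior {x : ℝ × ℝ | ![0, 0, x.1, x.2] ∈ S}

/-- `Pd(π₀; l, S)`, the set of the points where `π₀(l)` meets `π₀(S)`. -/
def piercings (l : Loop) (S : Set (Fin 4 → ℝ)) : Set (Fin 3 → ℝ) :=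
  (proj0 '' l.carrier) ∩ (proj0 '' S)

/-- `π₀(l)` crosses the `x₂`-`x₃` plane transversally wherever it meets `S`. -/
def PiercesTransversally (l : Loop) (S : Set (Fin 4 → ℝ)) : Prop :=
  ∀ s, proj0 (l s) ∈ proj0 '' S → deriv l.toFun s 1 ≠ 0

/-- `Iv` is a measurable partition of `I²` such that the loops with the color `γ_v` pierce `S`
only in the interior of the piece `S_v = σ(Iv v)`. -/
structure IsAdaptedPartition {n m : ℕ} (L : Fin n → Loop) (ρ : Fin n → Color)
    (γ : Fin m → Color) (σ : ℝ × ℝ → Fin 4 → ℝ) (S : Set (Fin 4 → ℝ))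
    (Iv : Fin m → Set (ℝ × ℝ)) : Prop where
  measurable : ∀ v, MeasurableSet (Iv v)
  disjoint : ∀ v w, v ≠ w → Disjoint (Iv v) (Iv w)
  cover : ⋃ v, Iv v = unitSquare
  pierce : ∀ v, ∀ u ∈ Gam ρ γ v, ∀ x ∈ piercings (L u) S,
    (x 1, x 2) ∈ planeInterior (σ '' Iv v)

/-! ### The Gaussian regularization -/

/-- `p_κ^x` on `ℝⁿ`; its square is the Gaussian density with center `x` and variance `1 / κ²`. -/
def pG {n : ℕ} (κ : ℝ) (x z : Fin n → ℝ) : ℝ :=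
  (κ / √(2 * Real.pi)) ^ ((n : ℝ) / 2) * Real.exp (-κ ^ 2 * (∑ a, (z a - x a) ^ 2) / 4)

/-- `q_κ^x` on `ℝ`. -/
def qG (κ x z : ℝ) : ℝ :=
  √κ / (2 * Real.pi) ^ (1 / 4 : ℝ) * Real.exp (-κ ^ 2 * (z - x) ^ 2 / 4)

/-- `∂⁻¹` on functions of one variable. -/
def dInv (f : ℝ → ℝ) (t : ℝ) : ℝ :=
  1 / 2 * (∫ s in Set.Iic t, f s) - 1 / 2 * (∫ s in Set.Ioi t, f s)

/-- `∂_a⁻¹` on functions on `ℝⁿ`. -/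
def dInvAt {n : ℕ} (a : Fin n) (f : (Fin n → ℝ) → ℝ) (x : Fin n → ℝ) : ℝ :=
  dInv (fun s => f (Function.update x a s)) (x a)

/-- `⟨f, g⟩ = ∫ f g dλ`. -/
def pair {X : Type*} [MeasureSpace X] (f g : X → ℝ) : ℝ := ∫ z, f z * g z

/-- `⟨p_κ^x, p_κ^y⟩_k` for `x, y ∈ ℝ⁴`. -/
def pairK (κ : ℝ) (k : Fin 3) (x y : Fin 4 → ℝ) : ℝ :=
  pair (pG κ (hat k x)) (pG κ (hat k y)) *
    pair (qG κ (x k.succ)) (fun t => κ * dInv (qG κ (y k.succ)) t) *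
    pair (dInv (qG κ (x 0))) (qG κ (y 0))

/-- The symbol `ε^{ijk}`. -/
def eps (i j k : Fin 3) : ℝ :=
  if (i, j, k) ∈ ({(0, 1, 2), (1, 2, 0), (2, 0, 1)} : Finset (Fin 3 × Fin 3 × Fin 3)) then 1
  else if (i, j, k) ∈ ({(1, 0, 2), (2, 1, 0), (0, 2, 1)} : Finset (Fin 3 × Fin 3 × Fin 3)) then -1
  else 0

/-- The double integral of `ε^{ijk} ⟨p_κ^{y_s}, p_κ^{ϱ_s̄}⟩_k y'_i ϱ'_j` over `I²`. -/
def linkIntegral (κ : ℝ) (l g : Loop) : ℝ :=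
  ∫ p in unitSquare, ∑ i : Fin 3, ∑ j : Fin 3, ∑ k : Fin 3,
    eps i j k * pairK κ k (l p.1) (g p.2) *
      deriv l.toFun p.1 i.succ * deriv g.toFun p.2 j.succ

/-- The coefficient of `𝓔` in the exponent of `Ŵ_κ⁻(q; l, G)`; that of `Ŵ_κ⁺` is its negative. -/
def holExponent {n : ℕ} (q κ : ℝ) (l : Loop) (G : Fin n → Loop) : ℂ :=
  Complex.I * q / 4 * ((κ ^ 3 / (4 * Real.pi) * ∑ v, linkIntegral κ l (G v) : ℝ) : ℂ)

/-- `κ / (2 √(4π))`. -/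
def kbar (κ : ℝ) : ℝ := κ / (2 * √(4 * Real.pi))

/-- The function `q ∑_{u ∈ A} κ ∫₀¹ y'_{1,s} ∂₀⁻¹ p_κ^{y_s} ds` on `ℝ⁴`. -/
def source {n : ℕ} (q κ : ℝ) (L : Fin n → Loop) (A : Finset (Fin n)) (z : Fin 4 → ℝ) : ℝ :=
  q * ∑ u ∈ A, κ * ∫ s in (0 : ℝ)..1, deriv (L u).toFun s 1 * dInvAt 0 (pG κ (L u s)) z

/-- `∑_v κbar³ ∫_{I_v²} |⟨source of Γ_v, p_κ^{σ(t)}⟩ √ξ_v| J₂₃(t) dt`, where `c γ_v` is the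
component `γ_v⁺` or `γ_v⁻`. -/
def areaBracket {n m : ℕ} (q κ : ℝ) (L : Fin n → Loop) (ρ : Fin n → Color) (γ : Fin m → Color)
    (c : Color → SU2Irrep) (σ : ℝ × ℝ → Fin 4 → ℝ) (Iv : Fin m → Set (ℝ × ℝ)) : ℝ :=
  ∑ v, kbar κ ^ 3 * ∫ t in Iv v,
    |pair (source q κ L (Gam ρ γ v)) (pG κ (σ t)) * √(c (γ v)).xi| * jac σ 2 3 t

/-- The regularized area path integral, before the limit `κ → ∞`. -/
def areaExpression {n m r : ℕ} (q κ : ℝ) (L : Fin n → Loop) (G : Fin r → Loop)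
    (ρ : Fin n → Color) (γ : Fin m → Color) (σ : ℝ × ℝ → Fin 4 → ℝ)
    (Iv : Fin m → Set (ℝ × ℝ)) : ℂ :=
  ∏ w, ((areaBracket q κ L ρ γ Color.plus σ Iv : ℂ) ^ (1 / n : ℂ) *
        (ρ w).plus.trExp (-holExponent q κ (L w) G) +
      (Complex.I * (areaBracket q κ L ρ γ Color.minus σ Iv : ℂ)) ^ (1 / n : ℂ) *
        (ρ w).minus.trExp (holExponent q κ (L w) G))

/-- `∑_u |Pd(π₀; l^u, S)| √ξ_u`. -/
def momentum {n : ℕ} (L : Fin n → Loop) (ρ : Fin n → Color) (c : Color → SU2Irrep)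
    (S : Set (Fin 4 → ℝ)) : ℝ :=
  ∑ u, ((piercings (L u) S).ncard : ℝ) * √(c (ρ u)).xi

end AreaLQG

end

open AreaLQG

namespace AreaLQG

theorem HasFDerivAt.exists_lower_bound {E : Type*} [NormedAddCommGroup E] [NormedSpace ℝ E]
    [FiniteDimensional ℝ E] {F : E → E} {A : E →L[ℝ] E} {p : E} (hA : HasFDerivAt F A p)
    (hinj : Function.Injective A) :
    ∃ c > 0, ∀ᶠ x in 𝓝 p, c * ‖x - p‖ ≤ ‖F x - F p‖ := by
  obtain ⟨K, hK, hanti⟩ := (A : E →ₗ[ℝ] E).exists_antilipschitzWith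
    (LinearMap.ker_eq_bot.2 hinj)
  have hK' : (0 : ℝ) < K := hK
  refine ⟨(2 * K)⁻¹, by positivity, ?_⟩
  filter_upwards [hA.isLittleO.bound (show (0 : ℝ) < (2 * (K : ℝ))⁻¹ by positivity)] with x hx
  have h1 : ‖x - p‖ ≤ K * ‖A (x - p)‖ := by
    simpa using hanti.le_mul_dist (x - p) 0
  have h2 : ‖A (x - p)‖ ≤ ‖F x - F p‖ + ‖F x - F p - A (x - p)‖ := by
    have := norm_sub_le (F x - F p) (F x - F p - A (x - p))
    simpa using this
  have h3 : (2 * (K : ℝ))⁻¹ * ‖x - p‖ * 2 ≤ ‖A (x - p)‖ := by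
    rw [mul_inv, mul_comm]
    field_simp
    linarith
  linarith

section Concentration

variable {E : Type*} [NormedAddCommGroup E] [NormedSpace ℝ E] [FiniteDimensional ℝ E]
  [Nontrivial E] [MeasurableSpace E] [BorelSpace E] (μ : Measure E) [μ.IsAddHaarMeasure]

/-- A continuous `2`-homogeneous function that is bounded below by a multiple of `‖x‖ ^ 2`. -/
structure IsCoerciveQuadratic (N : E → ℝ) : Prop where
  continuous : Continuous N
  smul : ∀ (c : ℝ) x, N (c • x) = c ^ 2 * N x
  coercive : ∃ c > 0, ∀ x, c * ‖x‖ ^ 2 ≤ N x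

theorem integrable_exp_neg_mul_norm_sq {b : ℝ} (hb : 0 < b) :
    Integrable (fun x : E => Real.exp (-b * ‖x‖ ^ 2)) μ := by
  rw [integrable_fun_norm_addHaar μ (f := fun y => Real.exp (-b * y ^ 2))]
  have h := (integrable_rpow_mul_exp_neg_mul_sq hb
    (s := ((Module.finrank ℝ E - 1 : ℕ) : ℝ))
    (lt_of_lt_of_le (by norm_num) (Nat.cast_nonneg _))).integrableOn (s := Set.Ioi 0)
  refine h.congr_fun (fun y _ => ?_) measurableSet_Ioi
  simp [Real.rpow_natCast]

variable {N : E → ℝ}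

/-- Concentration of `exp (-κ² N ∘ F)` near a nondegenerate zero of `F`. -/
theorem tendsto_concentration_local (hN : IsCoerciveQuadratic N) {F : E → E}
    (hF : Continuous F) {A : E →L[ℝ] E}
    {p : E} (hp : F p = 0) (hA : HasFDerivAt F A p) {V : Set E} (hV : MeasurableSet V)
    (hVp : V ∈ 𝓝 p) {c : ℝ} (hc : 0 < c) (hVc : ∀ x ∈ V, c * ‖x - p‖ ≤ ‖F x‖)
    {g : ℝ → E → ℝ} (hg : ∀ κ, Continuous (g κ)) {C : ℝ}
    (hgC : ∀ κ, ∀ x ∈ V, |g κ x| ≤ C) {g₀ : ℝ}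
    (hg₀ : Tendsto (fun z : ℝ × E => g z.1 z.2) (atTop ×ˢ 𝓝 p) (𝓝 g₀)) :
    Tendsto (fun κ : ℝ => κ ^ Module.finrank ℝ E *
        ∫ x in V, g κ x * Real.exp (-κ ^ 2 * N (F x)) ∂μ) atTop
      (𝓝 (g₀ * ∫ x, Real.exp (-N (A x)) ∂μ)) := by
  obtain ⟨c₀, hc₀, hNc⟩ := hN.coercive
  set H : ℝ → E → ℝ := fun κ => V.indicator fun x => g κ x * Real.exp (-κ ^ 2 * N (F x)) with hH
  have hresc : ∀ κ : ℝ, 0 < κ → κ ^ Module.finrank ℝ E *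
      ∫ x in V, g κ x * Real.exp (-κ ^ 2 * N (F x)) ∂μ = ∫ w, H κ (p + κ⁻¹ • w) ∂μ := by
    intro κ hκ
    rw [Measure.integral_comp_inv_smul μ (fun x => H κ (p + x)) κ,
      integral_add_left_eq_self (H κ) p, integral_indicator hV, abs_of_pos (by positivity),
      smul_eq_mul]
  have hev : ∀ᶠ κ : ℝ in atTop, ∫ w, H κ (p + κ⁻¹ • w) ∂μ = κ ^ Module.finrank ℝ E *
      ∫ x in V, g κ x * Real.exp (-κ ^ 2 * N (F x)) ∂μ := by
    filter_upwards [eventually_gt_atTop 0] with κ hκ using (hresc κ hκ).symm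
  refine Tendsto.congr' hev ?_
  rw [← integral_const_mul]
  refine tendsto_integral_filter_of_dominated_convergence
    (fun w => |C| * Real.exp (-(c₀ * c ^ 2) * ‖w‖ ^ 2)) ?_ ?_ ?_ ?_
  · refine Eventually.of_forall fun κ => ?_
    have hm : Measurable (H κ) := by
      refine Measurable.indicator ?_ hV
      have : Continuous fun x => g κ x * Real.exp (-κ ^ 2 * N (F x)) :=
        (hg κ).mul (Real.continuous_exp.comp (continuous_const.mul (hN.continuous.comp hF)))
      exact this.measurable
    have hsc : Continuous fun w : E => p + κ⁻¹ • w := by fun_prop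
    exact (hm.comp hsc.measurable).aestronglyMeasurable
  · filter_upwards [eventually_gt_atTop 0] with κ hκ
    refine Eventually.of_forall fun w => ?_
    simp only [hH]
    by_cases hw : p + κ⁻¹ • w ∈ V
    · rw [Set.indicator_of_mem hw, norm_mul, Real.norm_eq_abs, Real.norm_eq_abs, Real.abs_exp]
      refine mul_le_mul ((hgC κ _ hw).trans (le_abs_self C)) ?_ (Real.exp_pos _).le (abs_nonneg _)
      refine Real.exp_le_exp.2 ?_
      have h1 := hVc _ hw
      rw [add_sub_cancel_left, norm_smul, norm_inv, Real.norm_of_nonneg hκ.le] at h1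
      have h2 : (c * (κ⁻¹ * ‖w‖)) ^ 2 ≤ ‖F (p + κ⁻¹ • w)‖ ^ 2 :=
        pow_le_pow_left₀ (by positivity) h1 2
      have h3 := hNc (F (p + κ⁻¹ • w))
      have h4 : c₀ * (c * (κ⁻¹ * ‖w‖)) ^ 2 ≤ N (F (p + κ⁻¹ • w)) :=
        (mul_le_mul_of_nonneg_left h2 hc₀.le).trans h3
      have h5 : κ ^ 2 * (c₀ * (c * (κ⁻¹ * ‖w‖)) ^ 2) = c₀ * c ^ 2 * ‖w‖ ^ 2 := by
        field_simp
      nlinarith [mul_le_mul_of_nonneg_left h4 (sq_nonneg κ)]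
    · rw [Set.indicator_of_notMem hw, norm_zero]
      positivity
  · exact (integrable_exp_neg_mul_norm_sq μ (by positivity)).const_mul _
  · refine Eventually.of_forall fun w => ?_
    have hlim : Tendsto (fun κ : ℝ => p + κ⁻¹ • w) atTop (𝓝 p) := by
      have := (tendsto_inv_atTop_zero (𝕜 := ℝ)).smul_const w
      simpa using this.const_add p
    have hmem : ∀ᶠ κ : ℝ in atTop, p + κ⁻¹ • w ∈ V := hlim hVp
    have hgl : Tendsto (fun κ : ℝ => g κ (p + κ⁻¹ • w)) atTop (𝓝 g₀) :=
      hg₀.comp (tendsto_id.prodMk hlim)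
    have hd := hA.lim w (c := fun κ : ℝ => κ) (l := atTop) tendsto_norm_atTop_atTop
    have hNl : Tendsto (fun κ : ℝ => κ ^ 2 * N (F (p + κ⁻¹ • w))) atTop (𝓝 (N (A w))) := by
      have := (hN.continuous.tendsto (A w)).comp hd
      refine this.congr fun κ => ?_
      simp only [Function.comp_apply, hp, sub_zero, hN.smul]
    have hfin : Tendsto (fun κ : ℝ => g κ (p + κ⁻¹ • w) *
        Real.exp (-(κ ^ 2 * N (F (p + κ⁻¹ • w))))) atTop (𝓝 (g₀ * Real.exp (-N (A w)))) :=
      hgl.mul ((Real.continuous_exp.tendsto _).comp hNl.neg)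
    refine hfin.congr' ?_
    filter_upwards [hmem] with κ hκ
    simp only [hH, Set.indicator_of_mem hκ, neg_mul]

theorem tendsto_pow_mul_exp_neg_sq_mul (d : ℕ) {c : ℝ} (hc : 0 < c) :
    Tendsto (fun κ : ℝ => κ ^ d * Real.exp (-κ ^ 2 * c)) atTop (𝓝 0) := by
  have h := Real.tendsto_pow_mul_exp_neg_atTop_nhds_zero d
  have h1 : Tendsto (fun κ : ℝ => (c * κ) ^ d * Real.exp (-(c * κ))) atTop (𝓝 0) :=
    h.comp (tendsto_id.const_mul_atTop hc)
  have h2 := h1.const_mul ((c ^ d)⁻¹)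
  rw [mul_zero] at h2
  refine squeeze_zero' ?_ ?_ h2
  · filter_upwards [eventually_ge_atTop 0] with κ hκ
    positivity
  · filter_upwards [eventually_ge_atTop 1] with κ hκ
    rw [mul_pow, ← mul_assoc, ← mul_assoc, inv_mul_cancel₀ (by positivity), one_mul]
    gcongr
    nlinarith [mul_le_mul_of_nonneg_left hκ hc.le]

/-- Concentration of `exp (-κ² N ∘ F)` on the finitely many nondegenerate zeros of `F`. -/
theorem tendsto_concentration (hN : IsCoerciveQuadratic N) {F : E → E} (hF : Continuous F)
    {K K' : Set E} (hK : MeasurableSet K) (hKK' : K ⊆ K') (hK' : IsCompact K') (Z : Finset E)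
    (hZ : ∀ x ∈ K', F x = 0 → x ∈ Z) (hZ₀ : ∀ p ∈ Z, F p = 0) (hZK : ∀ p ∈ Z, K ∈ 𝓝 p)
    {A : E → E →L[ℝ] E} (hA : ∀ p ∈ Z, HasFDerivAt F (A p) p)
    (hinj : ∀ p ∈ Z, Function.Injective (A p))
    {g : ℝ → E → ℝ} (hg : ∀ κ, Continuous (g κ)) {C : ℝ} (hgC : ∀ κ, ∀ x ∈ K, |g κ x| ≤ C)
    {g₀ : E → ℝ}
    (hg₀ : ∀ p ∈ Z, Tendsto (fun z : ℝ × E => g z.1 z.2) (atTop ×ˢ 𝓝 p) (𝓝 (g₀ p))) :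
    Tendsto (fun κ : ℝ => κ ^ Module.finrank ℝ E *
        ∫ x in K, g κ x * Real.exp (-κ ^ 2 * N (F x)) ∂μ) atTop
      (𝓝 (∑ p ∈ Z, g₀ p * ∫ x, Real.exp (-N (A p x)) ∂μ)) := by
  classical
  have hμK : μ K ≠ ⊤ := ((measure_mono hKK').trans_lt hK'.measure_lt_top).ne
  obtain ⟨c₀, hc₀, hNc⟩ := hN.coercive
  have hN0 : ∀ x, 0 ≤ N x := fun x => le_trans (by positivity) (hNc x)
  have hcont : ∀ κ, Continuous fun x => g κ x * Real.exp (-κ ^ 2 * N (F x)) := fun κ =>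
    (hg κ).mul (Real.continuous_exp.comp (continuous_const.mul (hN.continuous.comp hF)))
  have hint : ∀ κ, IntegrableOn (fun x => g κ x * Real.exp (-κ ^ 2 * N (F x))) K μ := by
    intro κ
    refine Measure.integrableOn_of_bounded (M := C) hμK
      (hcont κ).aestronglyMeasurable ((ae_restrict_iff' hK).2 (Eventually.of_forall ?_))
    intro x hx
    rw [norm_mul, Real.norm_eq_abs, Real.norm_eq_abs, Real.abs_exp]
    have h1 : Real.exp (-κ ^ 2 * N (F x)) ≤ 1 :=
      Real.exp_le_one_iff.2 (by nlinarith [mul_nonneg (sq_nonneg κ) (hN0 (F x))])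
    nlinarith [hgC κ x hx, abs_nonneg (g κ x), Real.exp_pos (-κ ^ 2 * N (F x))]
  obtain ⟨U, hU, hUd⟩ := Z.finite_toSet.t2_separation
  have hV : ∀ p ∈ Z, ∃ c > 0, ∃ V, p ∈ V ∧ IsOpen V ∧ V ⊆ U p ∧ V ⊆ K ∧
      ∀ x ∈ V, c * ‖x - p‖ ≤ ‖F x‖ := by
    intro p hp
    obtain ⟨c, hc, hev⟩ := HasFDerivAt.exists_lower_bound (hA p hp) (hinj p hp)
    have h1 : U p ∈ 𝓝 p := (hU p).2.mem_nhds (hU p).1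
    obtain ⟨V, hVs, hVo, hpV⟩ := mem_nhds_iff.1 (inter_mem (inter_mem h1 (hZK p hp)) hev)
    refine ⟨c, hc, V, hpV, hVo, fun x hx => (hVs hx).1.1, fun x hx => (hVs hx).1.2, fun x hx => ?_⟩
    have := (hVs hx).2
    simpa [hZ₀ p hp] using this
  choose! c hc V hpV hVo hVU hVK hVc using hV
  set W : Set E := ⋃ p ∈ Z, V p with hW
  have hWo : IsOpen W := isOpen_biUnion fun p hp => hVo p hp
  have hWK : W ⊆ K := Set.iUnion₂_subset fun p hp => hVK p hp
  have hdisj : (Z : Set E).Pairwise (Function.onFun Disjoint V) := fun p hp q hq hpq =>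
    (hUd hp hq hpq).mono (hVU p hp) (hVU q hq)
  have hsplit : ∀ κ, ∫ x in K, g κ x * Real.exp (-κ ^ 2 * N (F x)) ∂μ =
      ∑ p ∈ Z, ∫ x in V p, g κ x * Real.exp (-κ ^ 2 * N (F x)) ∂μ +
        ∫ x in K \ W, g κ x * Real.exp (-κ ^ 2 * N (F x)) ∂μ := by
    intro κ
    rw [← integral_biUnion_finset Z (fun p hp => (hVo p hp).measurableSet) hdisj
      (fun p hp => (hint κ).mono_set (hVK p hp)), ← setIntegral_union Set.disjoint_sdiff_right
      (hK.diff hWo.measurableSet) ((hint κ).mono_set hWK) ((hint κ).mono_set Set.sdiff_subset),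
      Set.union_sdiff_cancel hWK]
  have hmain : Tendsto (fun κ : ℝ => ∑ p ∈ Z, κ ^ Module.finrank ℝ E *
      ∫ x in V p, g κ x * Real.exp (-κ ^ 2 * N (F x)) ∂μ) atTop
      (𝓝 (∑ p ∈ Z, g₀ p * ∫ x, Real.exp (-N (A p x)) ∂μ)) :=
    tendsto_finsetSum _ fun p hp => tendsto_concentration_local μ hN hF (hZ₀ p hp) (hA p hp)
      (hVo p hp).measurableSet ((hVo p hp).mem_nhds (hpV p hp)) (hc p hp) (hVc p hp) hg
      (fun κ x hx => hgC κ x (hVK p hp hx)) (hg₀ p hp)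
  have hrest : Tendsto (fun κ : ℝ => κ ^ Module.finrank ℝ E *
      ∫ x in K \ W, g κ x * Real.exp (-κ ^ 2 * N (F x)) ∂μ) atTop (𝓝 0) := by
    have hcomp : IsCompact (K' \ W) := hK'.diff hWo
    obtain ⟨c₁, hc₁, hlow⟩ : ∃ c₁ > 0, ∀ x ∈ K' \ W, c₁ ≤ N (F x) := by
      rcases (K' \ W).eq_empty_or_nonempty with he | hne
      · exact ⟨1, one_pos, by simp [he]⟩
      · obtain ⟨x₀, hx₀, hmin⟩ := hcomp.exists_isMinOn hne
          (hN.continuous.comp hF).continuousOn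
        refine ⟨N (F x₀), ?_, fun x hx => hmin hx⟩
        have hne0 : F x₀ ≠ 0 := fun h => hx₀.2
          (Set.mem_biUnion (hZ x₀ hx₀.1 h) (hpV x₀ (hZ x₀ hx₀.1 h)))
        exact lt_of_lt_of_le (by have := norm_pos_iff.2 hne0; positivity) (hNc (F x₀))
    have hz := (tendsto_pow_mul_exp_neg_sq_mul (Module.finrank ℝ E) hc₁).mul_const
      (|C| * μ.real (K \ W))
    rw [zero_mul] at hz
    refine squeeze_zero_norm' ?_ hz
    filter_upwards [eventually_ge_atTop 0] with κ hκ
    rw [norm_mul, Real.norm_of_nonneg (by positivity : (0 : ℝ) ≤ κ ^ Module.finrank ℝ E), mul_assoc]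
    refine mul_le_mul_of_nonneg_left ?_ (by positivity)
    rw [← mul_assoc]
    refine norm_setIntegral_le_of_norm_le_const
      ((measure_mono Set.sdiff_subset).trans_lt hμK.lt_top) fun x hx => ?_
    rw [norm_mul, Real.norm_eq_abs, Real.norm_eq_abs, Real.abs_exp, mul_comm]
    refine mul_le_mul (Real.exp_le_exp.2 ?_) ((hgC κ x hx.1).trans (le_abs_self C)) (abs_nonneg _)
      (Real.exp_pos _).le
    nlinarith [mul_le_mul_of_nonneg_left (hlow x ⟨hKK' hx.1, hx.2⟩) (sq_nonneg κ)]
  have := hmain.add hrest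
  rw [add_zero] at this
  refine this.congr fun κ => ?_
  rw [hsplit, mul_add, Finset.mul_sum]

end Concentration

/-- Linear change of variables in a function of `A x`. -/
theorem integral_comp_continuousLinearMap {E : Type*} [NormedAddCommGroup E]
    [NormedSpace ℝ E] [FiniteDimensional ℝ E] [MeasurableSpace E] [BorelSpace E] (μ : Measure E)
    [μ.IsAddHaarMeasure] {A : E →L[ℝ] E} (hA : A.det ≠ 0) {f : E → ℝ}
    (hf : Continuous f) : ∫ x, f (A x) ∂μ = |A.det|⁻¹ * ∫ x, f x ∂μ := by
  have h := Measure.map_linearMap_addHaar_eq_smul_addHaar μ (f := (A : E →ₗ[ℝ] E)) hA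
  have h1 : ∫ x, f x ∂(Measure.map A μ) = ∫ x, f (A x) ∂μ :=
    integral_map A.continuous.aemeasurable hf.aestronglyMeasurable
  rw [← h1]
  change ∫ x, f x ∂(Measure.map (A : E →ₗ[ℝ] E) μ) = _
  rw [h, integral_smul_measure, ENNReal.toReal_ofReal (abs_nonneg _), abs_inv, smul_eq_mul]

/-! ### One-dimensional kernels -/

/-- The pairing `⟨q_κ^x, ∂⁻¹ q_κ^y⟩` at `κ = 1`, as a function of `a = x - y`. -/
noncomputable def smear (a : ℝ) : ℝ := ∫ w, qG 1 0 w * dInv (qG 1 0) (w + a)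

theorem qG_scaling (κ x z : ℝ) : qG κ x z = √κ * qG 1 0 (κ * (z - x)) := by
  unfold qG
  rw [Real.sqrt_one, div_mul_eq_mul_div, div_mul_eq_mul_div, one_mul, mul_div_assoc]
  congr 3
  ring_nf

theorem qG_nonneg (κ x z : ℝ) : 0 ≤ qG κ x z := by
  unfold qG; positivity

theorem continuous_qG (κ : ℝ) : Continuous fun p : ℝ × ℝ => qG κ p.1 p.2 := by
  unfold qG; fun_prop

theorem qG_le (κ x z : ℝ) : qG κ x z ≤ √κ / (2 * Real.pi) ^ (1 / 4 : ℝ) := by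
  unfold qG
  refine mul_le_of_le_one_right (by positivity) (Real.exp_le_one_iff.2 ?_)
  nlinarith [mul_nonneg (sq_nonneg κ) (sq_nonneg (z - x))]

theorem rpow_quarter_mul_self : (2 * Real.pi) ^ (1 / 4 : ℝ) * (2 * Real.pi) ^ (1 / 4 : ℝ) =
    √(2 * Real.pi) := by
  rw [← Real.rpow_add (by positivity), Real.sqrt_eq_rpow]
  norm_num

theorem integrable_qG {κ : ℝ} (hκ : 0 < κ) (x : ℝ) : Integrable (qG κ x) := by
  have h := (integrable_exp_neg_mul_sq (b := κ ^ 2 / 4) (by positivity)).comp_sub_right x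
  refine (h.const_mul (√κ / (2 * Real.pi) ^ (1 / 4 : ℝ))).congr (Eventually.of_forall fun z => ?_)
  simp only [qG]
  ring_nf

theorem sq_integral_qG_one : (∫ w, qG 1 0 w) * (∫ w, qG 1 0 w) = 2 * √(2 * Real.pi) := by
  have h : ∫ w, qG 1 0 w = ((2 * Real.pi) ^ (1 / 4 : ℝ))⁻¹ * √(Real.pi / (1 / 4)) := by
    rw [← integral_gaussian, ← integral_const_mul]
    refine integral_congr_ae (Eventually.of_forall fun z => ?_)
    simp only [qG, Real.sqrt_one]
    ring_nf
  rw [h, mul_mul_mul_comm, ← mul_inv, rpow_quarter_mul_self, Real.mul_self_sqrt (by positivity)]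
  have : √(2 * Real.pi) * √(2 * Real.pi) = 2 * Real.pi := Real.mul_self_sqrt (by positivity)
  field_simp
  linarith [this, sq (√(2 * Real.pi))]

theorem dInv_eq {f : ℝ → ℝ} (hf : Integrable f) (t : ℝ) :
    dInv f t = 1 / 2 * (∫ s, f s) - ∫ s in Set.Ioi t, f s := by
  have h := integral_add_compl (measurableSet_Ioi (a := t)) hf
  rw [Set.compl_Ioi] at h
  unfold dInv
  linarith

theorem dInv_eq_Iic {f : ℝ → ℝ} (hf : Integrable f) (t : ℝ) :
    dInv f t = (∫ s in Set.Iic t, f s) - 1 / 2 * (∫ s, f s) := by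
  have h := integral_add_compl (measurableSet_Ioi (a := t)) hf
  rw [Set.compl_Ioi] at h
  unfold dInv
  linarith

theorem abs_dInv_le {f : ℝ → ℝ} (hf : Integrable f) (h0 : ∀ s, 0 ≤ f s) (t : ℝ) :
    |dInv f t| ≤ 1 / 2 * ∫ s, f s := by
  have h := integral_add_compl (measurableSet_Ioi (a := t)) hf
  rw [Set.compl_Ioi] at h
  have h1 : 0 ≤ ∫ s in Set.Ioi t, f s := integral_nonneg h0
  have h2 : 0 ≤ ∫ s in Set.Iic t, f s := integral_nonneg h0
  unfold dInv
  rw [abs_le]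
  constructor <;> linarith

theorem continuous_dInv {f : ℝ → ℝ} (hf : Integrable f) : Continuous (dInv f) := by
  have h : dInv f = fun t => (∫ s in (0 : ℝ)..t, f s) +
      ((∫ s in Set.Iic 0, f s) - 1 / 2 * (∫ s, f s)) := by
    funext t
    rw [dInv_eq_Iic hf, ← intervalIntegral.integral_Iic_sub_Iic hf.integrableOn hf.integrableOn]
    ring
  rw [h]
  exact (intervalIntegral.continuous_primitive (fun a b => hf.intervalIntegrable) 0).add
    continuous_const

theorem tendsto_dInv_atTop {f : ℝ → ℝ} (hf : Integrable f) :
    Tendsto (dInv f) atTop (𝓝 (1 / 2 * ∫ s, f s)) := by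
  have h := (aecover_Iic (μ := (volume : Measure ℝ))
    (tendsto_id (α := ℝ) (x := atTop))).integral_tendsto_of_countably_generated hf
  have h2 := h.sub_const (1 / 2 * ∫ s, f s)
  refine (h2.congr fun t => (dInv_eq_Iic hf t).symm).trans (le_of_eq ?_)
  congr 1; ring

theorem tendsto_dInv_atBot {f : ℝ → ℝ} (hf : Integrable f) :
    Tendsto (dInv f) atBot (𝓝 (-(1 / 2 * ∫ s, f s))) := by
  have h := (aecover_Ioi (μ := (volume : Measure ℝ))
    (tendsto_id (α := ℝ) (x := atBot))).integral_tendsto_of_countably_generated hf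
  have h2 := h.const_sub (1 / 2 * ∫ s, f s)
  refine (h2.congr fun t => (dInv_eq hf t).symm).trans (le_of_eq ?_)
  congr 1; ring

theorem dInv_qG_scaling {κ : ℝ} (hκ : 0 < κ) (x t : ℝ) :
    dInv (qG κ x) t = √κ * κ⁻¹ * dInv (qG 1 0) (κ * (t - x)) := by
  have key : ∀ f : ℝ → ℝ, ∫ s, f (κ * (s - x)) = κ⁻¹ * ∫ s, f s := by
    intro f
    rw [integral_sub_right_eq_self (fun s => f (κ * s)) x, Measure.integral_comp_mul_left,
      abs_of_pos (inv_pos.2 hκ), smul_eq_mul]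
  have hset : ∫ s in Set.Ioi t, qG κ x s =
      √κ * (κ⁻¹ * ∫ s in Set.Ioi (κ * (t - x)), qG 1 0 s) := by
    rw [← integral_indicator measurableSet_Ioi (f := qG 1 0), ← key, ← integral_const_mul,
      ← integral_indicator measurableSet_Ioi]
    refine integral_congr_ae (Eventually.of_forall fun s => ?_)
    by_cases hs : t < s
    · have hs' : κ * (t - x) < κ * (s - x) := by gcongr
      simp [Set.indicator, hs, hs', qG_scaling κ x s]
    · have hs' : ¬ κ * (t - x) < κ * (s - x) := by
        push Not at hs ⊢; gcongr
      simp only [Set.indicator, Set.mem_Ioi, hs, hs', if_false, mul_zero]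
  have htot : ∫ s, qG κ x s = √κ * (κ⁻¹ * ∫ s, qG 1 0 s) := by
    rw [← key, ← integral_const_mul]
    simp_rw [qG_scaling κ x]
  rw [dInv_eq (integrable_qG hκ x), dInv_eq (integrable_qG one_pos 0), hset, htot]
  ring

theorem pair_qG_dInv {κ : ℝ} (hκ : 0 < κ) (x y : ℝ) :
    pair (qG κ x) (dInv (qG κ y)) = κ⁻¹ * smear (κ * (x - y)) := by
  unfold pair smear
  have key : ∀ f : ℝ → ℝ, ∫ s, f (κ * (s - x)) = κ⁻¹ * ∫ s, f s := by
    intro f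
    rw [integral_sub_right_eq_self (fun s => f (κ * s)) x, Measure.integral_comp_mul_left,
      abs_of_pos (inv_pos.2 hκ), smul_eq_mul]
  rw [← key]
  refine integral_congr_ae (Eventually.of_forall fun z => ?_)
  simp only
  rw [qG_scaling κ x, dInv_qG_scaling hκ]
  have h1 : √κ * √κ = κ := Real.mul_self_sqrt hκ.le
  have h2 : κ * (z - x) + κ * (x - y) = κ * (z - y) := by ring
  rw [h2]
  calc _ = (√κ * √κ) * κ⁻¹ * (qG 1 0 (κ * (z - x)) * dInv (qG 1 0) (κ * (z - y))) := by ring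
    _ = _ := by rw [h1, mul_inv_cancel₀ hκ.ne', one_mul]

theorem pair_dInv_qG {κ : ℝ} (hκ : 0 < κ) (x y : ℝ) :
    pair (dInv (qG κ x)) (qG κ y) = κ⁻¹ * smear (κ * (y - x)) := by
  rw [← pair_qG_dInv hκ]
  simp only [pair, mul_comm]

theorem continuous_smear : Continuous smear := by
  have hi := integrable_qG one_pos 0
  have hc := continuous_dInv hi
  have hq : Continuous (qG 1 0) := (continuous_qG 1).comp (continuous_const.prodMk continuous_id)
  refine continuous_of_dominated (bound := fun w => qG 1 0 w * (1 / 2 * ∫ s, qG 1 0 s)) ?_ ?_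
    (hi.mul_const _) ?_
  · intro a
    exact (hq.mul (hc.comp (by fun_prop))).aestronglyMeasurable
  · refine fun a => Eventually.of_forall fun w => ?_
    rw [norm_mul, Real.norm_of_nonneg (qG_nonneg _ _ _)]
    exact mul_le_mul_of_nonneg_left (abs_dInv_le hi (qG_nonneg 1 0) _) (qG_nonneg _ _ _)
  · exact Eventually.of_forall fun w => continuous_const.mul (hc.comp (by fun_prop))

theorem abs_smear_le (a : ℝ) : |smear a| ≤ √(2 * Real.pi) := by
  have hi := integrable_qG one_pos 0
  have h : ‖smear a‖ ≤ ∫ w, qG 1 0 w * (1 / 2 * ∫ s, qG 1 0 s) := by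
    refine norm_integral_le_of_norm_le (hi.mul_const _) (Eventually.of_forall fun w => ?_)
    rw [norm_mul, Real.norm_of_nonneg (qG_nonneg _ _ _)]
    exact mul_le_mul_of_nonneg_left (abs_dInv_le hi (qG_nonneg 1 0) _) (qG_nonneg _ _ _)
  rw [integral_mul_const] at h
  rw [Real.norm_eq_abs] at h
  linarith [sq_integral_qG_one]

theorem tendsto_smear_of {l : Filter ℝ} [l.IsCountablyGenerated] {c : ℝ}
    (hl : ∀ w : ℝ, Tendsto (fun a => dInv (qG 1 0) (w + a)) l (𝓝 c)) :
    Tendsto smear l (𝓝 ((∫ w, qG 1 0 w) * c)) := by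
  have hi := integrable_qG one_pos 0
  have hc := continuous_dInv hi
  have hq : Continuous (qG 1 0) := (continuous_qG 1).comp (continuous_const.prodMk continuous_id)
  rw [← integral_mul_const]
  refine tendsto_integral_filter_of_dominated_convergence
    (fun w => qG 1 0 w * (1 / 2 * ∫ s, qG 1 0 s)) ?_ ?_ (hi.mul_const _) ?_
  · exact Eventually.of_forall fun a => (hq.mul (hc.comp (by fun_prop))).aestronglyMeasurable
  · refine Eventually.of_forall fun a => Eventually.of_forall fun w => ?_
    rw [norm_mul, Real.norm_of_nonneg (qG_nonneg _ _ _)]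
    exact mul_le_mul_of_nonneg_left (abs_dInv_le hi (qG_nonneg 1 0) _) (qG_nonneg _ _ _)
  · exact Eventually.of_forall fun w => (hl w).const_mul _

theorem tendsto_smear_atTop : Tendsto smear atTop (𝓝 √(2 * Real.pi)) := by
  have h := tendsto_smear_of (l := atTop) fun w =>
    (tendsto_dInv_atTop (integrable_qG one_pos 0)).comp (tendsto_atTop_add_const_left _ w tendsto_id)
  refine h.trans (le_of_eq ?_)
  congr 1
  linarith [sq_integral_qG_one]

theorem tendsto_smear_atBot : Tendsto smear atBot (𝓝 (-√(2 * Real.pi))) := by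
  have h := tendsto_smear_of (l := atBot) fun w =>
    (tendsto_dInv_atBot (integrable_qG one_pos 0)).comp (tendsto_atBot_add_const_left _ w tendsto_id)
  refine h.trans (le_of_eq ?_)
  congr 1
  linarith [sq_integral_qG_one]

/-- `smear (κ h)` converges to `√(2π) sgn h`, locally uniformly off the zeros of `h`. -/
theorem tendsto_smear_mul {X : Type*} [TopologicalSpace X] {h : X → ℝ} {p : X}
    (hc : ContinuousAt h p) (hp : h p ≠ 0) :
    Tendsto (fun z : ℝ × X => smear (z.1 * h z.2)) (atTop ×ˢ 𝓝 p)
      (𝓝 (√(2 * Real.pi) * (SignType.sign (h p) : ℤ))) := by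
  have hh : Tendsto (fun z : ℝ × X => h z.2) (atTop ×ˢ 𝓝 p) (𝓝 (h p)) :=
    hc.tendsto.comp tendsto_snd
  have h1 : Tendsto (fun z : ℝ × X => z.1) (atTop ×ˢ 𝓝 p) atTop := tendsto_fst
  rcases hp.lt_or_gt with h0 | h0
  · rw [sign_neg h0]
    have := tendsto_smear_atBot.comp (h1.atTop_mul_neg h0 hh)
    simpa [Function.comp_def] using this
  · rw [sign_pos h0]
    have := tendsto_smear_atTop.comp (h1.atTop_mul_pos h0 hh)
    simpa [Function.comp_def] using this

/-! ### Gaussian pairings -/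

theorem pair_qG_qG {κ : ℝ} (hκ : 0 < κ) (x y : ℝ) :
    pair (qG κ x) (qG κ y) = Real.exp (-κ ^ 2 * ((x - y) ^ 2 / 8)) := by
  have hg : ∫ z : ℝ, Real.exp (-(κ ^ 2 / 2) * z ^ 2) = √(2 * Real.pi) / κ := by
    rw [integral_gaussian, show Real.pi / (κ ^ 2 / 2) = 2 * Real.pi / κ ^ 2 by field_simp,
      Real.sqrt_div' _ (by positivity), Real.sqrt_sq hκ.le]
  have h : ∀ z, qG κ x z * qG κ y z = κ / √(2 * Real.pi) *
      Real.exp (-κ ^ 2 * ((x - y) ^ 2 / 8)) *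
        Real.exp (-(κ ^ 2 / 2) * (z - (x + y) / 2) ^ 2) := by
    intro z
    unfold qG
    rw [mul_mul_mul_comm, ← Real.exp_add, div_mul_div_comm, rpow_quarter_mul_self,
      Real.mul_self_sqrt hκ.le, mul_assoc _ (Real.exp _), ← Real.exp_add]
    congr 2
    ring
  unfold pair
  simp_rw [h]
  rw [integral_const_mul,
    integral_sub_right_eq_self (fun z => Real.exp (-(κ ^ 2 / 2) * z ^ 2)) ((x + y) / 2), hg]
  have : √(2 * Real.pi) ≠ 0 := by positivity
  field_simp

theorem pG_eq_prod {n : ℕ} {κ : ℝ} (hκ : 0 < κ) (x z : Fin n → ℝ) :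
    pG κ x z = ∏ a, qG κ (x a) (z a) := by
  unfold pG qG
  rw [Finset.prod_mul_distrib, Finset.prod_const, Finset.card_univ, Fintype.card_fin,
    ← Real.exp_sum]
  congr 1
  · have h : √κ / (2 * Real.pi) ^ (1 / 4 : ℝ) = (κ / √(2 * Real.pi)) ^ (1 / 2 : ℝ) := by
      rw [Real.div_rpow hκ.le (by positivity), Real.sqrt_eq_rpow, Real.sqrt_eq_rpow,
        ← Real.rpow_mul (by positivity)]
      norm_num
    rw [h, ← Real.rpow_natCast, ← Real.rpow_mul (by positivity)]
    congr 1; ring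
  · rw [Finset.mul_sum, Finset.sum_div]

theorem pair_pG_pG {n : ℕ} {κ : ℝ} (hκ : 0 < κ) (x y : Fin n → ℝ) :
    pair (pG κ x) (pG κ y) = Real.exp (-κ ^ 2 * ((∑ a, (x a - y a) ^ 2) / 8)) := by
  unfold pair
  simp_rw [pG_eq_prod hκ, ← Finset.prod_mul_distrib]
  rw [integral_fintype_prod_volume_eq_prod (fun a t => qG κ (x a) t * qG κ (y a) t)]
  have := fun a => pair_qG_qG hκ (x a) (y a)
  unfold pair at this
  simp_rw [this]
  rw [← Real.exp_sum, Finset.sum_div, Finset.mul_sum]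

theorem pairK_eq {κ : ℝ} (hκ : 0 < κ) (k : Fin 3) (x y : Fin 4 → ℝ) :
    pairK κ k x y = κ⁻¹ * (smear (κ * (x k.succ - y k.succ)) * smear (κ * (y 0 - x 0)) *
      Real.exp (-κ ^ 2 * (((hat k x 0 - hat k y 0) ^ 2 + (hat k x 1 - hat k y 1) ^ 2) / 8))) := by
  unfold pairK
  have h : pair (qG κ (x k.succ)) (fun t => κ * dInv (qG κ (y k.succ)) t) =
      smear (κ * (x k.succ - y k.succ)) := by
    have h1 := pair_qG_dInv hκ (x k.succ) (y k.succ)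
    unfold pair at h1 ⊢
    have h2 : ∀ z, qG κ (x k.succ) z * (κ * dInv (qG κ (y k.succ)) z) =
        κ * (qG κ (x k.succ) z * dInv (qG κ (y k.succ)) z) := fun z => by ring
    simp_rw [h2]
    rw [integral_const_mul, h1, mul_inv_cancel_left₀ hκ.ne']
  rw [h, pair_pG_pG hκ, pair_dInv_qG hκ, Fin.sum_univ_two]
  ring

theorem dInvAt_pG {κ : ℝ} (hκ : 0 < κ) (x z : Fin 4 → ℝ) :
    dInvAt 0 (pG κ x) z =
      dInv (qG κ (x 0)) (z 0) * ∏ i : Fin 3, qG κ (x i.succ) (z i.succ) := by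
  unfold dInvAt
  have h : ∀ s, pG κ x (Function.update z 0 s) =
      qG κ (x 0) s * ∏ i : Fin 3, qG κ (x i.succ) (z i.succ) := by
    intro s
    rw [pG_eq_prod hκ, Fin.prod_univ_succ]
    simp
  simp_rw [h]
  unfold dInv
  rw [integral_mul_const, integral_mul_const]
  ring

theorem pair_dInvAt_pG {κ : ℝ} (hκ : 0 < κ) (x y : Fin 4 → ℝ) :
    pair (dInvAt 0 (pG κ x)) (pG κ y) = κ⁻¹ * (smear (κ * (y 0 - x 0)) *
      Real.exp (-κ ^ 2 * ((∑ i : Fin 3, (x i.succ - y i.succ) ^ 2) / 8))) := by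
  have h : ∀ z : Fin 4 → ℝ, dInvAt 0 (pG κ x) z * pG κ y z = ∏ a : Fin 4,
      (Fin.cons (α := fun _ => ℝ → ℝ) (fun t => dInv (qG κ (x 0)) t * qG κ (y 0) t)
        (fun i : Fin 3 => fun t => qG κ (x i.succ) t * qG κ (y i.succ) t)) a (z a) := by
    intro z
    rw [dInvAt_pG hκ, pG_eq_prod hκ, Fin.prod_univ_succ (n := 3), Fin.prod_univ_succ (n := 3)]
    simp only [Fin.cons_zero, Fin.cons_succ, Finset.prod_mul_distrib]
    ring
  unfold pair
  simp_rw [h]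
  rw [integral_fintype_prod_volume_eq_prod, Fin.prod_univ_succ]
  simp only [Fin.cons_zero, Fin.cons_succ]
  have h1 := pair_dInv_qG hκ (x 0) (y 0)
  have h2 := fun i : Fin 3 => pair_qG_qG hκ (x i.succ) (y i.succ)
  unfold pair at h1 h2
  rw [h1]
  simp_rw [h2]
  rw [← Real.exp_sum, Finset.sum_div, Finset.mul_sum, mul_assoc]

/-! ### Loops -/

theorem Loop.continuous (l : Loop) : Continuous l.toFun := l.contDiff.continuous

theorem Loop.continuous_deriv (l : Loop) : Continuous (deriv l.toFun) :=
  l.contDiff.continuous_deriv le_rfl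

theorem Loop.hasDerivAt (l : Loop) (s : ℝ) : HasDerivAt l.toFun (deriv l.toFun s) s :=
  ((l.contDiff.differentiable one_ne_zero) s).hasDerivAt

theorem Loop.periodic_deriv (l : Loop) : Function.Periodic (deriv l.toFun) 1 := by
  intro s
  have h : (fun x => l.toFun (x + 1)) = l.toFun := funext l.periodic
  rw [← deriv_comp_add_const, h]

theorem Loop.apply_fract (l : Loop) (s : ℝ) : l.toFun (Int.fract s) = l.toFun s := by
  have := l.periodic.sub_int_mul_eq (x := s) ⌊s⌋
  rwa [mul_one] at this

theorem Loop.deriv_fract (l : Loop) (s : ℝ) :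
    deriv l.toFun (Int.fract s) = deriv l.toFun s := by
  have := l.periodic_deriv.sub_int_mul_eq (x := s) ⌊s⌋
  rwa [mul_one] at this

theorem Loop.fract_eq_of_apply_eq (l : Loop) {s t : ℝ} (h : l.toFun s = l.toFun t) :
    Int.fract s = Int.fract t :=
  l.injOn ⟨Int.fract_nonneg s, Int.fract_lt_one s⟩ ⟨Int.fract_nonneg t, Int.fract_lt_one t⟩
    (by rw [l.apply_fract, l.apply_fract, h])

/-! ### The pairing of the source with a Gaussian -/

theorem integrable_pG {n : ℕ} {κ : ℝ} (hκ : 0 < κ) (y : Fin n → ℝ) : Integrable (pG κ y) := by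
  have h : pG κ y = fun z => ∏ a, qG κ (y a) (z a) := funext fun z => pG_eq_prod hκ y z
  rw [h]
  exact Integrable.fintype_prod fun a => integrable_qG hκ (y a)

theorem pG_nonneg {n : ℕ} {κ : ℝ} (hκ : 0 < κ) (y z : Fin n → ℝ) : 0 ≤ pG κ y z := by
  unfold pG; positivity

theorem continuous_dInvAt_pG {κ : ℝ} (hκ : 0 < κ) :
    Continuous fun p : (Fin 4 → ℝ) × (Fin 4 → ℝ) => dInvAt 0 (pG κ p.1) p.2 := by
  simp_rw [dInvAt_pG hκ, dInv_qG_scaling hκ]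
  have hc := continuous_dInv (integrable_qG one_pos 0)
  refine (continuous_const.mul (hc.comp (by fun_prop))).mul (continuous_finsetProd _ fun i _ => ?_)
  exact (continuous_qG κ).comp
    (by fun_prop : Continuous fun p : (Fin 4 → ℝ) × (Fin 4 → ℝ) => (p.1 i.succ, p.2 i.succ))

theorem exists_abs_dInvAt_pG_le {κ : ℝ} (hκ : 0 < κ) :
    ∃ B, ∀ x z : Fin 4 → ℝ, |dInvAt 0 (pG κ x) z| ≤ B := by
  refine ⟨√κ * κ⁻¹ * (1 / 2 * ∫ s, qG 1 0 s) * (√κ / (2 * Real.pi) ^ (1 / 4 : ℝ)) ^ 3,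
    fun x z => ?_⟩
  have hnn : 0 ≤ ∏ i : Fin 3, qG κ (x i.succ) (z i.succ) :=
    Finset.prod_nonneg fun i _ => qG_nonneg _ _ _
  rw [dInvAt_pG hκ, dInv_qG_scaling hκ, abs_mul, abs_mul, abs_of_nonneg hnn,
    abs_of_nonneg (by positivity : 0 ≤ √κ * κ⁻¹)]
  have h1 := abs_dInv_le (integrable_qG one_pos 0) (qG_nonneg 1 0) (κ * (z 0 - x 0))
  have h2 : ∏ i : Fin 3, qG κ (x i.succ) (z i.succ) ≤
      (√κ / (2 * Real.pi) ^ (1 / 4 : ℝ)) ^ 3 := by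
    calc _ ≤ ∏ _i : Fin 3, √κ / (2 * Real.pi) ^ (1 / 4 : ℝ) :=
          Finset.prod_le_prod (fun i _ => qG_nonneg _ _ _) fun i _ => qG_le _ _ _
      _ = _ := by rw [Finset.prod_const, Finset.card_univ, Fintype.card_fin]
  have h3 : 0 ≤ 1 / 2 * ∫ s, qG 1 0 s := (abs_nonneg _).trans h1
  gcongr

theorem integrable_source_integrand {κ : ℝ} (hκ : 0 < κ) (l : Loop) (y : Fin 4 → ℝ) :
    Integrable (Function.uncurry fun (z : Fin 4 → ℝ) (s : ℝ) =>
        deriv l.toFun s 1 * dInvAt 0 (pG κ (l s)) z * pG κ y z)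
      (volume.prod (volume.restrict (Set.Ioc 0 1))) := by
  obtain ⟨B, hB⟩ := exists_abs_dInvAt_pG_le hκ
  have hd : Continuous fun s => deriv l.toFun s 1 := (continuous_apply 1).comp l.continuous_deriv
  obtain ⟨C, hC⟩ := (isCompact_Icc (a := (0 : ℝ)) (b := 1)).exists_bound_of_continuousOn
    hd.continuousOn
  have hcont : Continuous (Function.uncurry fun (z : Fin 4 → ℝ) (s : ℝ) =>
        deriv l.toFun s 1 * dInvAt 0 (pG κ (l s)) z * pG κ y z) := by
    refine ((hd.comp continuous_snd).mul ((continuous_dInvAt_pG hκ).comp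
      ((l.continuous.comp continuous_snd).prodMk continuous_fst))).mul ?_
    have : Continuous (pG κ y) := by unfold pG; fun_prop
    exact this.comp continuous_fst
  have hbound : Integrable (fun p : (Fin 4 → ℝ) × ℝ => |C| * |B| * pG κ y p.1)
      (volume.prod (volume.restrict (Set.Ioc 0 1))) :=
    ((integrable_pG hκ y).comp_fst _).const_mul _
  refine hbound.mono' hcont.aestronglyMeasurable ?_
  have hae : ∀ᵐ p : (Fin 4 → ℝ) × ℝ ∂(volume.prod (volume.restrict (Set.Ioc 0 1))),
      p.2 ∈ Set.Ioc (0 : ℝ) 1 :=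
    Measure.quasiMeasurePreserving_snd.ae (ae_restrict_mem measurableSet_Ioc)
  filter_upwards [hae] with p hp
  simp only [Function.uncurry]
  rw [norm_mul, norm_mul, Real.norm_of_nonneg (pG_nonneg hκ _ _)]
  refine mul_le_mul_of_nonneg_right ?_ (pG_nonneg hκ _ _)
  exact mul_le_mul ((hC _ (Set.Ioc_subset_Icc_self hp)).trans (le_abs_self C))
    ((hB _ _).trans (le_abs_self B)) (norm_nonneg _) (abs_nonneg _)

theorem pair_source {n : ℕ} (q : ℝ) {κ : ℝ} (hκ : 0 < κ) (L : Fin n → Loop) (A : Finset (Fin n))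
    (y : Fin 4 → ℝ) :
    pair (source q κ L A) (pG κ y) = q * ∑ u ∈ A, ∫ s in (0 : ℝ)..1,
      deriv (L u).toFun s 1 * (smear (κ * (y 0 - L u s 0)) *
        Real.exp (-κ ^ 2 * ((∑ i : Fin 3, (L u s i.succ - y i.succ) ^ 2) / 8))) := by
  have hz : ∀ z, source q κ L A z * pG κ y z = q * ∑ u ∈ A, κ * ∫ s in Set.Ioc (0 : ℝ) 1,
      deriv (L u).toFun s 1 * dInvAt 0 (pG κ (L u s)) z * pG κ y z := by
    intro z
    unfold source
    rw [mul_assoc, Finset.sum_mul]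
    simp_rw [intervalIntegral.integral_of_le zero_le_one, integral_mul_const, mul_assoc]
  unfold pair
  simp_rw [hz]
  have hi : ∀ u ∈ A, Integrable fun z => κ * ∫ s in Set.Ioc (0 : ℝ) 1,
      deriv (L u).toFun s 1 * dInvAt 0 (pG κ (L u s)) z * pG κ y z := fun u _ =>
    ((integrable_source_integrand hκ (L u) y).integral_prod_left).const_mul κ
  rw [integral_const_mul, integral_finsetSum _ hi]
  congr 1
  refine Finset.sum_congr rfl fun u _ => ?_
  rw [integral_const_mul, integral_integral_swap (integrable_source_integrand hκ (L u) y),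
    intervalIntegral.integral_of_le zero_le_one, ← integral_const_mul]
  refine integral_congr_ae (Eventually.of_forall fun s => ?_)
  simp only [mul_assoc]
  rw [integral_const_mul]
  have := pair_dInvAt_pG hκ (L u s) y
  unfold pair at this
  rw [this]
  field_simp

/-! ### Auxiliary facts -/

/-- A continuous map has finitely many zeros in a compact set if they are nondegenerate. -/
theorem finite_zeros_of_nondegenerate {E : Type*} [NormedAddCommGroup E] [NormedSpace ℝ E]
    [FiniteDimensional ℝ E] {F : E → E} (hF : Continuous F) {K : Set E} (hK : IsCompact K)
    {A : E → E →L[ℝ] E} (hA : ∀ x ∈ K, F x = 0 → HasFDerivAt F (A x) x)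
    (hinj : ∀ x ∈ K, F x = 0 → Function.Injective (A x)) : {x ∈ K | F x = 0}.Finite := by
  have hZ : IsCompact {x ∈ K | F x = 0} :=
    hK.inter_right (isClosed_singleton.preimage hF)
  have hiso : ∀ x ∈ {x ∈ K | F x = 0}, {y | F y = 0 → y = x} ∈ 𝓝 x := by
    rintro x ⟨hxK, hx⟩
    obtain ⟨c, hc, hev⟩ := HasFDerivAt.exists_lower_bound (hA x hxK hx) (hinj x hxK hx)
    filter_upwards [hev] with y hy hy0
    rw [hy0, hx, sub_zero, norm_zero] at hy
    have : ‖y - x‖ = 0 := le_antisymm (by nlinarith) (norm_nonneg _)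
    exact sub_eq_zero.1 (norm_eq_zero.1 this)
  obtain ⟨t, -, ht⟩ := hZ.elim_nhds_subcover _ hiso
  refine t.finite_toSet.subset fun y hy => ?_
  obtain ⟨x, hx, hyx⟩ := Set.mem_iUnion₂.1 (ht hy)
  have : y = x := hyx hy.2
  exact this ▸ hx

theorem det_eq_two (A : ℝ × ℝ →L[ℝ] ℝ × ℝ) :
    A.det = (A (1, 0)).1 * (A (0, 1)).2 - (A (0, 1)).1 * (A (1, 0)).2 := by
  have h : A = LinearMap.toContinuousLinearMap (Matrix.toLin (Module.Basis.finTwoProd ℝ)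
      (Module.Basis.finTwoProd ℝ) !![(A (1, 0)).1, (A (0, 1)).1; (A (1, 0)).2, (A (0, 1)).2]) := by
    rw [Matrix.toLin_finTwoProd_toContinuousLinearMap]
    ext <;> simp
  conv_lhs => rw [h]
  rw [LinearMap.det_toContinuousLinearMap, LinearMap.det_toLin, Matrix.det_fin_two_of]

theorem injective_of_det_ne_zero {E : Type*} [NormedAddCommGroup E] [NormedSpace ℝ E]
    [FiniteDimensional ℝ E] {A : E →L[ℝ] E} (hA : A.det ≠ 0) : Function.Injective A :=
  (LinearMap.equivOfDetNeZero (A : E →ₗ[ℝ] E) hA).injective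

/-- The quadratic form `(x² + y²) / 8`. -/
noncomputable def quad2 (x : ℝ × ℝ) : ℝ := (x.1 ^ 2 + x.2 ^ 2) / 8

theorem norm_sq_le_quad2 (x : ℝ × ℝ) : 1 / 8 * ‖x‖ ^ 2 ≤ quad2 x := by
  unfold quad2
  rw [Prod.norm_def, Real.norm_eq_abs, Real.norm_eq_abs]
  rcases max_cases |x.1| |x.2| with h | h <;> rw [h.1, sq_abs] <;>
    nlinarith [sq_nonneg x.1, sq_nonneg x.2]

theorem isCoerciveQuadratic_quad2 : IsCoerciveQuadratic quad2 where
  continuous := by unfold quad2; fun_prop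
  smul c x := by simp only [quad2, Prod.smul_fst, Prod.smul_snd, smul_eq_mul]; ring
  coercive := ⟨1 / 8, by norm_num, norm_sq_le_quad2⟩

theorem integral_exp_neg_sq_div_eight :
    ∫ x : ℝ, Real.exp (-(x ^ 2 / 8)) = √(8 * Real.pi) := by
  have h := integral_gaussian (1 / 8)
  rw [show Real.pi / (1 / 8) = 8 * Real.pi by ring] at h
  rw [← h]
  congr 1; funext x; congr 1; ring

theorem integral_exp_neg_quad2 : ∫ x, Real.exp (-quad2 x) = 8 * Real.pi := by
  have h : ∀ x : ℝ × ℝ, Real.exp (-quad2 x) =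
      Real.exp (-(x.1 ^ 2 / 8)) * Real.exp (-(x.2 ^ 2 / 8)) := by
    intro x
    rw [← Real.exp_add, quad2]; congr 1; ring
  simp_rw [h]
  rw [Measure.volume_eq_prod, integral_prod_mul (fun x : ℝ => Real.exp (-(x ^ 2 / 8)))
    (fun x : ℝ => Real.exp (-(x ^ 2 / 8))), integral_exp_neg_sq_div_eight,
    Real.mul_self_sqrt (by positivity)]

theorem injOn_fract_Ico (a : ℝ) : Set.InjOn Int.fract (Set.Ico a (a + 1)) := by
  intro x hx y hy h
  obtain ⟨z, hz⟩ := Int.fract_eq_fract.1 h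
  have h1 : (z : ℝ) < 1 := by linarith [hx.2, hy.1]
  have h2 : (-1 : ℝ) < z := by linarith [hx.1, hy.2]
  have h3 : z < 1 := by exact_mod_cast h1
  have h4 : -1 < z := by exact_mod_cast h2
  obtain rfl : z = 0 := by omega
  simp at hz; linarith

theorem exists_mem_Ico_fract_eq {a t : ℝ} (ha : a ∈ Set.Ico (0 : ℝ) 1)
    (ht : t ∈ Set.Ico (0 : ℝ) 1) : ∃ s ∈ Set.Ico a (a + 1), Int.fract s = t := by
  rcases le_or_gt a t with h | h
  · exact ⟨t, ⟨h, by linarith [ht.2, ha.1]⟩, Int.fract_eq_self.2 ht⟩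
  · refine ⟨t + 1, ⟨by linarith [ha.2, ht.1], by linarith⟩, ?_⟩
    rw [Int.fract_add_one, Int.fract_eq_self.2 ht]

theorem setIntegral_unitSquare_eq_shift {f : ℝ × ℝ → ℝ} (hf : Continuous f)
    (h1 : ∀ s t, f (s + 1, t) = f (s, t)) (h2 : ∀ s t, f (s, t + 1) = f (s, t)) (a b : ℝ) :
    ∫ p in unitSquare, f p = ∫ p in Set.Icc a (a + 1) ×ˢ Set.Icc b (b + 1), f p := by
  have key : ∀ a b : ℝ, ∫ p in Set.Icc a (a + 1) ×ˢ Set.Icc b (b + 1), f p =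
      ∫ s in a..a + 1, ∫ t in b..b + 1, f (s, t) := by
    intro a b
    rw [Measure.volume_eq_prod, setIntegral_prod _
      (hf.continuousOn.integrableOn_compact (isCompact_Icc.prod isCompact_Icc)),
      intervalIntegral.integral_of_le (by linarith), integral_Icc_eq_integral_Ioc]
    simp_rw [intervalIntegral.integral_of_le (show b ≤ b + 1 by linarith),
      integral_Icc_eq_integral_Ioc]
  have h0 := key 0 0
  rw [zero_add] at h0
  rw [unitSquare, h0, key]
  have hin : ∀ s, ∫ t in (0 : ℝ)..1, f (s, t) = ∫ t in b..b + 1, f (s, t) := by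
    intro s
    have := Function.Periodic.intervalIntegral_add_eq (f := fun t => f (s, t)) (T := 1) (h2 s) 0 b
    rwa [zero_add] at this
  simp_rw [hin]
  have := Function.Periodic.intervalIntegral_add_eq
    (f := fun s => ∫ t in b..b + 1, f (s, t)) (T := 1) (fun s => by simp only [h1]) 0 a
  rwa [zero_add] at this

/-! ### The limit of the link integral -/

/-- The projection `x ↦ x̂_k`, as a continuous linear map into `ℝ × ℝ`. -/
noncomputable def planeL (k : Fin 3) : (Fin 4 → ℝ) →L[ℝ] ℝ × ℝ :=
  (ContinuousLinearMap.proj (R := ℝ) (φ := fun _ : Fin 4 => ℝ) (![2, 1, 1] k)).prod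
    (ContinuousLinearMap.proj (![3, 3, 2] k))

theorem planeL_apply (k : Fin 3) (x : Fin 4 → ℝ) : planeL k x = (hat k x 0, hat k x 1) := by
  fin_cases k <;> simp [planeL, hat]

theorem hat_eq_iff {k : Fin 3} {x y : Fin 4 → ℝ} :
    hat k x = hat k y ↔ planeL k x = planeL k y := by
  simp [planeL_apply, funext_iff, Fin.forall_fin_two]

/-- The difference of the projections of two loops. -/
noncomputable def linkMap (k : Fin 3) (l g : Loop) (p : ℝ × ℝ) : ℝ × ℝ :=
  planeL k (l p.1) - planeL k (g p.2)

/-- The derivative of `linkMap`. -/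
noncomputable def linkDeriv (k : Fin 3) (l g : Loop) (p : ℝ × ℝ) : ℝ × ℝ →L[ℝ] ℝ × ℝ :=
  (ContinuousLinearMap.fst ℝ ℝ ℝ).smulRight (planeL k (deriv l.toFun p.1)) -
    (ContinuousLinearMap.snd ℝ ℝ ℝ).smulRight (planeL k (deriv g.toFun p.2))

theorem continuous_linkMap (k : Fin 3) (l g : Loop) : Continuous (linkMap k l g) :=
  ((planeL k).continuous.comp (l.continuous.comp continuous_fst)).sub
    ((planeL k).continuous.comp (g.continuous.comp continuous_snd))

theorem hasFDerivAt_linkMap (k : Fin 3) (l g : Loop) (p : ℝ × ℝ) :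
    HasFDerivAt (linkMap k l g) (linkDeriv k l g p) p := by
  have h1 := ((planeL k).hasFDerivAt.comp p.1 (l.hasDerivAt p.1).hasFDerivAt).comp p
    (hasFDerivAt_fst (𝕜 := ℝ))
  have h2 := ((planeL k).hasFDerivAt.comp p.2 (g.hasDerivAt p.2).hasFDerivAt).comp p
    (hasFDerivAt_snd (𝕜 := ℝ))
  refine (h1.sub h2).congr_fderiv ?_
  ext <;> simp [linkDeriv]

theorem abs_det_linkDeriv (k : Fin 3) (l g : Loop) (p : ℝ × ℝ) :
    |(linkDeriv k l g p).det| = |cross k (deriv l.toFun p.1) (deriv g.toFun p.2)| := by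
  rw [det_eq_two]
  fin_cases k
  · rw [← abs_neg]
    simp [linkDeriv, planeL, cross]; ring_nf
  · simp [linkDeriv, planeL, cross]; ring_nf
  · rw [← abs_neg]
    simp [linkDeriv, planeL, cross]; ring_nf

/-- The amplitude of the link integrand: the factor in front of the planar Gaussian. -/
noncomputable def linkAmp (k : Fin 3) (l g : Loop) (κ : ℝ) (p : ℝ × ℝ) : ℝ :=
  cross k (deriv l.toFun p.1) (deriv g.toFun p.2) *
    (smear (κ * (l p.1 k.succ - g p.2 k.succ)) * smear (κ * (g p.2 0 - l p.1 0)))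

theorem continuous_cross (k : Fin 3) :
    Continuous fun p : (Fin 4 → ℝ) × (Fin 4 → ℝ) => cross k p.1 p.2 := by
  fin_cases k <;> simp only [cross] <;> simp <;> fun_prop

theorem continuous_cross_deriv (k : Fin 3) (l g : Loop) :
    Continuous fun p : ℝ × ℝ => cross k (deriv l.toFun p.1) (deriv g.toFun p.2) :=
  (continuous_cross k).comp ((l.continuous_deriv.comp continuous_fst).prodMk
    (g.continuous_deriv.comp continuous_snd))

theorem continuous_coord_sub (i : Fin 4) (l g : Loop) :
    Continuous fun p : ℝ × ℝ => l p.1 i - g p.2 i :=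
  ((continuous_apply i).comp (l.continuous.comp continuous_fst)).sub
    ((continuous_apply i).comp (g.continuous.comp continuous_snd))

theorem continuous_coord_sub' (i : Fin 4) (l g : Loop) :
    Continuous fun p : ℝ × ℝ => g p.2 i - l p.1 i :=
  ((continuous_apply i).comp (g.continuous.comp continuous_snd)).sub
    ((continuous_apply i).comp (l.continuous.comp continuous_fst))

theorem continuous_linkAmp (k : Fin 3) (l g : Loop) (κ : ℝ) : Continuous (linkAmp k l g κ) :=
  (continuous_cross_deriv k l g).mul
    ((continuous_smear.comp (continuous_const.mul (continuous_coord_sub _ l g))).mul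
      (continuous_smear.comp (continuous_const.mul (continuous_coord_sub' _ l g))))

theorem abs_linkAmp_le (k : Fin 3) (l g : Loop) (κ : ℝ) (p : ℝ × ℝ) :
    |linkAmp k l g κ p| ≤ |cross k (deriv l.toFun p.1) (deriv g.toFun p.2)| *
      (√(2 * Real.pi) * √(2 * Real.pi)) := by
  unfold linkAmp
  rw [abs_mul, abs_mul]
  have h2 := abs_smear_le (κ * (l p.1 k.succ - g p.2 k.succ))
  have h3 := abs_smear_le (κ * (g p.2 0 - l p.1 0))
  gcongr

/-- The limit of `linkAmp` at a crossing. -/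
noncomputable def linkAmpLim (k : Fin 3) (l g : Loop) (p : ℝ × ℝ) : ℝ :=
  cross k (deriv l.toFun p.1) (deriv g.toFun p.2) *
    (√(2 * Real.pi) * (SignType.sign (l p.1 k.succ - g p.2 k.succ) : ℤ) *
      (√(2 * Real.pi) * (SignType.sign (g p.2 0 - l p.1 0) : ℤ)))

theorem tendsto_linkAmp (k : Fin 3) (l g : Loop) (p : ℝ × ℝ)
    (h₁ : l p.1 k.succ - g p.2 k.succ ≠ 0) (h₂ : g p.2 0 - l p.1 0 ≠ 0) :
    Tendsto (fun z : ℝ × ℝ × ℝ => linkAmp k l g z.1 z.2) (atTop ×ˢ 𝓝 p)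
      (𝓝 (linkAmpLim k l g p)) := by
  have t0 : Tendsto (fun z : ℝ × ℝ × ℝ => cross k (deriv l.toFun z.2.1) (deriv g.toFun z.2.2))
      (atTop ×ˢ 𝓝 p) (𝓝 (cross k (deriv l.toFun p.1) (deriv g.toFun p.2))) :=
    ((continuous_cross_deriv k l g).tendsto p).comp tendsto_snd
  have t1 := tendsto_smear_mul (h := fun p : ℝ × ℝ => l p.1 k.succ - g p.2 k.succ)
    (continuous_coord_sub _ l g).continuousAt h₁
  have t2 := tendsto_smear_mul (h := fun p : ℝ × ℝ => g p.2 0 - l p.1 0)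
    (continuous_coord_sub' _ l g).continuousAt h₂
  exact t0.mul (t1.mul t2)

theorem self_mul_inv_abs_eq_sign {x : ℝ} (hx : x ≠ 0) : x * |x|⁻¹ = (SignType.sign x : ℤ) := by
  rcases hx.lt_or_gt with h | h
  · rw [sign_neg h, abs_of_neg h]; field_simp; norm_num
  · rw [sign_pos h, abs_of_pos h]; field_simp; norm_num

theorem tendsto_linkAmp_integral (k : Fin 3) (l g : Loop) (hcross : CrossTransversally l g)
    (hsep : ∀ s t, hat k (l s) = hat k (g t) →
      l s k.succ - g t k.succ ≠ 0 ∧ g t 0 - l s 0 ≠ 0) :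
    Tendsto (fun κ : ℝ => κ ^ 2 * ∫ p in unitSquare,
        linkAmp k l g κ p * Real.exp (-κ ^ 2 * quad2 (linkMap k l g p))) atTop
      (𝓝 (16 * Real.pi ^ 2 * (∑ᶠ p ∈ crossings k l g, crossingSign k l g p : ℤ))) := by
  have hfr : ∀ p : ℝ × ℝ, linkMap k l g p = 0 →
      ((Int.fract p.1, Int.fract p.2) : ℝ × ℝ) ∈ crossings k l g := by
    intro p hp
    refine ⟨⟨Int.fract_nonneg _, Int.fract_lt_one _⟩, ⟨Int.fract_nonneg _, Int.fract_lt_one _⟩, ?_⟩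
    rw [l.apply_fract, g.apply_fract]
    exact hat_eq_iff.2 (sub_eq_zero.1 hp)
  have hne : ∀ p, linkMap k l g p = 0 →
      cross k (deriv l.toFun p.1) (deriv g.toFun p.2) ≠ 0 := by
    intro p hp
    have := hcross k _ (hfr p hp)
    rwa [l.deriv_fract, g.deriv_fract] at this
  have hdet : ∀ p, linkMap k l g p = 0 → (linkDeriv k l g p).det ≠ 0 := by
    intro p hp
    rw [← abs_pos, abs_det_linkDeriv, abs_pos]
    exact hne p hp
  have hfin : ∀ a b : ℝ,
      {p ∈ Set.Icc a (a + 1) ×ˢ Set.Icc b (b + 1) | linkMap k l g p = 0}.Finite :=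
    fun a b => finite_zeros_of_nondegenerate (continuous_linkMap k l g)
      (isCompact_Icc.prod isCompact_Icc) (fun p _ _ => hasFDerivAt_linkMap k l g p)
      (fun p _ hp => injective_of_det_ne_zero (hdet p hp))
  have hcfin : (crossings k l g).Finite := by
    refine (hfin 0 0).subset fun p hp => ⟨⟨?_, ?_⟩, ?_⟩
    · exact ⟨hp.1.1, by linarith [hp.1.2]⟩
    · exact ⟨hp.2.1.1, by linarith [hp.2.1.2]⟩
    · exact sub_eq_zero.2 (hat_eq_iff.1 hp.2.2)
  obtain ⟨a, ha, ha'⟩ := ((Set.Ico_infinite (zero_lt_one (α := ℝ))).sdiff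
    (hcfin.image Prod.fst)).nonempty
  obtain ⟨b, hb, hb'⟩ := ((Set.Ico_infinite (zero_lt_one (α := ℝ))).sdiff
    (hcfin.image Prod.snd)).nonempty
  set K : Set (ℝ × ℝ) := Set.Icc a (a + 1) ×ˢ Set.Icc b (b + 1) with hK
  have hKc : IsCompact K := isCompact_Icc.prod isCompact_Icc
  set Z := (hfin a b).toFinset with hZ
  have hZmem : ∀ p, p ∈ Z ↔ p ∈ K ∧ linkMap k l g p = 0 := by
    intro p; rw [hZ, Set.Finite.mem_toFinset]; rfl
  have hfa : Int.fract a = a := Int.fract_eq_self.2 ha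
  have hfb : Int.fract b = b := Int.fract_eq_self.2 hb
  have hint : ∀ p ∈ Z, p.1 ∈ Set.Ioo a (a + 1) ∧ p.2 ∈ Set.Ioo b (b + 1) := by
    intro p hp
    obtain ⟨⟨h1, h2⟩, h0⟩ := (hZmem p).1 hp
    have hc := hfr p h0
    have na : Int.fract p.1 ≠ a := fun h => ha' ⟨_, hc, h⟩
    have nb : Int.fract p.2 ≠ b := fun h => hb' ⟨_, hc, h⟩
    refine ⟨⟨lt_of_le_of_ne h1.1 ?_, lt_of_le_of_ne h1.2 ?_⟩,
      ⟨lt_of_le_of_ne h2.1 ?_, lt_of_le_of_ne h2.2 ?_⟩⟩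
    · rintro h; exact na (by rw [← h, hfa])
    · rintro h; exact na (by rw [h, Int.fract_add_one, hfa])
    · rintro h; exact nb (by rw [← h, hfb])
    · rintro h; exact nb (by rw [h, Int.fract_add_one, hfb])
  obtain ⟨C, hC⟩ := hKc.exists_bound_of_continuousOn (continuous_cross_deriv k l g).continuousOn
  have hlim := tendsto_concentration (volume : Measure (ℝ × ℝ)) isCoerciveQuadratic_quad2
    (continuous_linkMap k l g) (K := K) (K' := K) hKc.measurableSet subset_rfl hKc Z
    (fun p hp h0 => (hZmem p).2 ⟨hp, h0⟩) (fun p hp => ((hZmem p).1 hp).2)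
    (fun p hp => prod_mem_nhds (Icc_mem_nhds (hint p hp).1.1 (hint p hp).1.2)
      (Icc_mem_nhds (hint p hp).2.1 (hint p hp).2.2))
    (A := linkDeriv k l g) (fun p _ => hasFDerivAt_linkMap k l g p)
    (fun p hp => injective_of_det_ne_zero (hdet p ((hZmem p).1 hp).2))
    (g := linkAmp k l g) (continuous_linkAmp k l g)
    (C := |C| * (√(2 * Real.pi) * √(2 * Real.pi)))
    (fun κ p hp => (abs_linkAmp_le k l g κ p).trans (mul_le_mul_of_nonneg_right
      ((hC p hp).trans (le_abs_self C)) (by positivity)))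
    (g₀ := linkAmpLim k l g)
    (fun p hp => by
      have h0 := hsep p.1 p.2 (hat_eq_iff.2 (sub_eq_zero.1 ((hZmem p).1 hp).2))
      exact tendsto_linkAmp k l g p h0.1 h0.2)
  have hrank : Module.finrank ℝ (ℝ × ℝ) = 2 := by simp
  rw [hrank] at hlim
  have hper : ∀ κ, ∫ p in unitSquare, linkAmp k l g κ p *
      Real.exp (-κ ^ 2 * quad2 (linkMap k l g p)) = ∫ p in K, linkAmp k l g κ p *
      Real.exp (-κ ^ 2 * quad2 (linkMap k l g p)) := by
    intro κ
    refine setIntegral_unitSquare_eq_shift ?_ ?_ ?_ a b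
    · exact (continuous_linkAmp k l g κ).mul (Real.continuous_exp.comp (continuous_const.mul
        (isCoerciveQuadratic_quad2.continuous.comp (continuous_linkMap k l g))))
    · intro s t
      simp only [linkAmp, linkMap, l.periodic s, l.periodic_deriv s]
    · intro s t
      simp only [linkAmp, linkMap, g.periodic t, g.periodic_deriv t]
  simp_rw [hper]
  refine hlim.trans (le_of_eq ?_)
  congr 1
  have hbij : Set.BijOn (fun p : ℝ × ℝ => ((Int.fract p.1, Int.fract p.2) : ℝ × ℝ))
      (Z : Set (ℝ × ℝ)) (crossings k l g) := by
    refine ⟨fun p hp => hfr p ((hZmem p).1 hp).2, ?_, ?_⟩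
    · intro p hp p' hp' h
      obtain ⟨h1, h2⟩ := Prod.mk.inj h
      have i1 := hint p hp
      have i2 := hint p' hp'
      exact Prod.ext (injOn_fract_Ico a (Set.Ioo_subset_Ico_self i1.1)
        (Set.Ioo_subset_Ico_self i2.1) h1) (injOn_fract_Ico b (Set.Ioo_subset_Ico_self i1.2)
        (Set.Ioo_subset_Ico_self i2.2) h2)
    · rintro ⟨s, t⟩ ⟨hs, ht, hst⟩
      obtain ⟨s', hs', rfl⟩ := exists_mem_Ico_fract_eq ha hs
      obtain ⟨t', ht', rfl⟩ := exists_mem_Ico_fract_eq hb ht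
      refine ⟨(s', t'), (hZmem _).2 ⟨⟨Set.Ico_subset_Icc_self hs', Set.Ico_subset_Icc_self ht'⟩, ?_⟩,
        rfl⟩
      simp only [l.apply_fract, g.apply_fract] at hst
      exact sub_eq_zero.2 (hat_eq_iff.1 hst)
  have hsum : ∑ᶠ p ∈ crossings k l g, crossingSign k l g p = ∑ p ∈ Z, crossingSign k l g p := by
    rw [← finsum_mem_coe_finset]
    refine (finsum_mem_eq_of_bijOn _ hbij fun p _ => ?_).symm
    simp only [crossingSign, l.apply_fract, g.apply_fract, l.deriv_fract, g.deriv_fract]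
  rw [hsum, Int.cast_sum, Finset.mul_sum]
  refine Finset.sum_congr rfl fun p hp => ?_
  have h0 := ((hZmem p).1 hp).2
  rw [integral_comp_continuousLinearMap volume (hdet p h0) (f := fun x => Real.exp (-quad2 x))
    (Real.continuous_exp.comp isCoerciveQuadratic_quad2.continuous.neg), integral_exp_neg_quad2,
    abs_det_linkDeriv]
  have hs := self_mul_inv_abs_eq_sign (hne p h0)
  have hpi : √(2 * Real.pi) * √(2 * Real.pi) = 2 * Real.pi := Real.mul_self_sqrt (by positivity)
  unfold crossingSign linkAmpLim
  push_cast at hs ⊢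
  rw [← hs]
  linear_combination (cross k (deriv l.toFun p.1) (deriv g.toFun p.2) *
    |cross k (deriv l.toFun p.1) (deriv g.toFun p.2)|⁻¹ *
      (SignType.sign (l p.1 k.succ - g p.2 k.succ) : ℝ) *
      (SignType.sign (g p.2 0 - l p.1 0) : ℝ) * (8 * Real.pi)) * hpi

theorem linkIntegrand_eq {κ : ℝ} (hκ : 0 < κ) (l g : Loop) (p : ℝ × ℝ) :
    (∑ i : Fin 3, ∑ j : Fin 3, ∑ k : Fin 3, eps i j k * pairK κ k (l p.1) (g p.2) *
      deriv l.toFun p.1 i.succ * deriv g.toFun p.2 j.succ) =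
    κ⁻¹ * ∑ k : Fin 3, linkAmp k l g κ p * Real.exp (-κ ^ 2 * quad2 (linkMap k l g p)) := by
  have h : ∀ k, pairK κ k (l p.1) (g p.2) * cross k (deriv l.toFun p.1) (deriv g.toFun p.2) =
      κ⁻¹ * (linkAmp k l g κ p * Real.exp (-κ ^ 2 * quad2 (linkMap k l g p))) := by
    intro k
    rw [pairK_eq hκ, linkAmp, linkMap, planeL_apply, planeL_apply, quad2]
    simp only [Prod.fst_sub, Prod.snd_sub]
    ring
  rw [Finset.mul_sum]
  simp_rw [← h]
  simp only [Fin.sum_univ_three, eps, cross]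
  simp [Fin.ext_iff]
  ring

theorem tendsto_linkIntegral (l g : Loop) (hcross : CrossTransversally l g)
    (hsep : ∀ k s t, hat k (l s) = hat k (g t) →
      l s k.succ - g t k.succ ≠ 0 ∧ g t 0 - l s 0 ≠ 0) :
    Tendsto (fun κ : ℝ => κ ^ 3 * linkIntegral κ l g) atTop (𝓝 (16 * Real.pi ^ 2 * sk l g)) := by
  have h := tendsto_finsetSum Finset.univ fun k (_ : k ∈ Finset.univ) =>
    tendsto_linkAmp_integral k l g hcross (hsep k)
  have hsum : ∑ k : Fin 3, 16 * Real.pi ^ 2 *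
      ((∑ᶠ p ∈ crossings k l g, crossingSign k l g p : ℤ) : ℝ) = 16 * Real.pi ^ 2 * sk l g := by
    rw [sk, Int.cast_sum, Finset.mul_sum]
  rw [hsum] at h
  refine h.congr' ?_
  filter_upwards [eventually_gt_atTop 0] with κ hκ
  unfold linkIntegral
  simp_rw [linkIntegrand_eq hκ]
  rw [integral_const_mul, integral_finsetSum, ← Finset.mul_sum, ← mul_assoc]
  · congr 1
    field_simp
  · intro k _
    refine ContinuousOn.integrableOn_compact (isCompact_Icc.prod isCompact_Icc)
      (Continuous.continuousOn ?_)
    exact (continuous_linkAmp k l g κ).mul (Real.continuous_exp.comp (continuous_const.mul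
        (isCoerciveQuadratic_quad2.continuous.comp (continuous_linkMap k l g))))

/-! ### Concentration of the source at the piercings -/

theorem IsCoerciveQuadratic.integrable_exp_neg_comp {E : Type*} [NormedAddCommGroup E]
    [NormedSpace ℝ E] [FiniteDimensional ℝ E] [Nontrivial E] [MeasurableSpace E] [BorelSpace E]
    (μ : Measure E) [μ.IsAddHaarMeasure] {N : E → ℝ} (hN : IsCoerciveQuadratic N) {A : E →L[ℝ] E}
    (hA : Function.Injective A) : Integrable (fun x => Real.exp (-N (A x))) μ := by
  obtain ⟨c, hc, hNc⟩ := hN.coercive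
  obtain ⟨K, hK, hanti⟩ := (A : E →ₗ[ℝ] E).exists_antilipschitzWith (LinearMap.ker_eq_bot.2 hA)
  have hK' : (0 : ℝ) < K := hK
  refine (integrable_exp_neg_mul_norm_sq μ (b := c / K ^ 2) (by positivity)).mono'
    (Real.continuous_exp.comp (hN.continuous.comp A.continuous).neg).aestronglyMeasurable
    (Eventually.of_forall fun x => ?_)
  rw [Real.norm_eq_abs, Real.abs_exp]
  refine Real.exp_le_exp.2 ?_
  have h1 : ‖x‖ ≤ K * ‖A x‖ := by simpa using hanti.le_mul_dist x 0
  have h2 : ‖x‖ ^ 2 ≤ (K * ‖A x‖) ^ 2 := pow_le_pow_left₀ (norm_nonneg _) h1 2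
  have h3 : c / (K : ℝ) ^ 2 * ‖x‖ ^ 2 ≤ c * ‖A x‖ ^ 2 := by
    rw [div_mul_eq_mul_div, div_le_iff₀ (by positivity)]
    nlinarith
  linarith [hNc (A x)]

/-- The quadratic form `(x² + y² + z²) / 8`. -/
noncomputable def quad3 (x : (ℝ × ℝ) × ℝ) : ℝ := quad2 x.1 + x.2 ^ 2 / 8

theorem isCoerciveQuadratic_quad3 : IsCoerciveQuadratic quad3 where
  continuous := by unfold quad3 quad2; fun_prop
  smul c x := by
    simp only [quad3, Prod.smul_fst, Prod.smul_snd, smul_eq_mul, isCoerciveQuadratic_quad2.smul]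
    ring
  coercive := by
    refine ⟨1 / 8, by norm_num, fun x => ?_⟩
    have h1 := norm_sq_le_quad2 x.1
    unfold quad3
    rw [Prod.norm_def]
    rcases max_cases ‖x.1‖ ‖x.2‖ with h | h <;> rw [h.1]
    · nlinarith [sq_nonneg x.2]
    · rw [Real.norm_eq_abs, sq_abs]
      nlinarith [sq_nonneg ‖x.1‖]

instance isAddHaarMeasure_volume_prod_prod :
    (volume : Measure ((ℝ × ℝ) × ℝ)).IsAddHaarMeasure :=
  inferInstanceAs ((volume : Measure (ℝ × ℝ)).prod (volume : Measure ℝ)).IsAddHaarMeasure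

/-- The displacement from the point `x` of the `x₂`-`x₃` plane to the point `π₀ (l s)`. -/
noncomputable def pierceMap (l : Loop) (p : (ℝ × ℝ) × ℝ) : (ℝ × ℝ) × ℝ :=
  (planeL 0 (l p.2) - p.1, l p.2 1)

/-- The derivative of `pierceMap`, in terms of the velocity `v` of the loop. -/
noncomputable def pierceDeriv (v : Fin 4 → ℝ) : (ℝ × ℝ) × ℝ →L[ℝ] (ℝ × ℝ) × ℝ :=
  ((ContinuousLinearMap.snd ℝ (ℝ × ℝ) ℝ).smulRight (planeL 0 v) -
    ContinuousLinearMap.fst ℝ (ℝ × ℝ) ℝ).prod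
      ((ContinuousLinearMap.snd ℝ (ℝ × ℝ) ℝ).smulRight (v 1))

theorem continuous_pierceMap (l : Loop) : Continuous (pierceMap l) :=
  (((planeL 0).continuous.comp (l.continuous.comp continuous_snd)).sub continuous_fst).prodMk
    ((continuous_apply 1).comp (l.continuous.comp continuous_snd))

theorem hasFDerivAt_pierceMap (l : Loop) (p : (ℝ × ℝ) × ℝ) :
    HasFDerivAt (pierceMap l) (pierceDeriv (deriv l.toFun p.2)) p := by
  have h1 := ((planeL 0).hasFDerivAt.comp p.2 (l.hasDerivAt p.2).hasFDerivAt).comp p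
    (hasFDerivAt_snd (𝕜 := ℝ))
  have h2 := ((hasDerivAt_pi.1 (l.hasDerivAt p.2) 1).hasFDerivAt).comp p
    (hasFDerivAt_snd (𝕜 := ℝ))
  refine ((h1.sub (hasFDerivAt_fst (𝕜 := ℝ))).prodMk h2).congr_fderiv ?_
  ext <;> simp [pierceDeriv]

theorem injective_pierceDeriv {v : Fin 4 → ℝ} (hv : v 1 ≠ 0) :
    Function.Injective (pierceDeriv v) := by
  rw [injective_iff_map_eq_zero]
  rintro ⟨w, r⟩ h
  have h2 : r * v 1 = 0 := congrArg Prod.snd h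
  have hr : r = 0 := (mul_eq_zero.1 h2).resolve_right hv
  have h1 : r • planeL 0 v - w = 0 := congrArg Prod.fst h
  rw [hr, zero_smul, zero_sub, neg_eq_zero] at h1
  rw [h1, hr]; rfl

theorem integral_exp_neg_quad3_pierceDeriv {v : Fin 4 → ℝ} (hv : v 1 ≠ 0) :
    ∫ x, Real.exp (-quad3 (pierceDeriv v x)) = 8 * Real.pi * √(8 * Real.pi) * |v 1|⁻¹ := by
  have hi := isCoerciveQuadratic_quad3.integrable_exp_neg_comp volume (injective_pierceDeriv hv)
  rw [Measure.volume_eq_prod] at hi ⊢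
  rw [integral_prod_symm _ hi]
  have hin : ∀ r : ℝ, ∫ w : ℝ × ℝ, Real.exp (-quad3 (pierceDeriv v (w, r))) =
      8 * Real.pi * Real.exp (-((v 1 * r) ^ 2 / 8)) := by
    intro r
    have h : ∀ w : ℝ × ℝ, Real.exp (-quad3 (pierceDeriv v (w, r))) =
        Real.exp (-quad2 (r • planeL 0 v - w)) * Real.exp (-((v 1 * r) ^ 2 / 8)) := by
      intro w
      rw [← Real.exp_add]
      congr 1
      change -(quad2 (r • planeL 0 v - w) + (r * v 1) ^ 2 / 8) = _
      ring
    simp_rw [h]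
    rw [integral_mul_const,
      integral_sub_left_eq_self (fun w => Real.exp (-quad2 w)) volume (r • planeL 0 v),
      integral_exp_neg_quad2]
  simp_rw [hin]
  rw [integral_const_mul, Measure.integral_comp_mul_left (fun y => Real.exp (-(y ^ 2 / 8))) (v 1),
    integral_exp_neg_sq_div_eight, abs_inv, smul_eq_mul]
  ring

/-- The trace of `S` on the `x₂`-`x₃` plane. -/
def planeSet (S : Set (Fin 4 → ℝ)) : Set (ℝ × ℝ) := {x | ![0, 0, x.1, x.2] ∈ S}

theorem eq_of_planar {x : Fin 4 → ℝ} (h : x 0 = 0 ∧ x 1 = 0) : ![0, 0, x 2, x 3] = x := by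
  ext i; fin_cases i <;> simp [h.1, h.2]

theorem isCompact_planeSet {S : Set (Fin 4 → ℝ)} (hS : IsCompact S)
    (hp : ∀ x ∈ S, x 0 = 0 ∧ x 1 = 0) : IsCompact (planeSet S) := by
  have h : planeSet S = (fun x : Fin 4 → ℝ => (x 2, x 3)) '' S := by
    ext x
    constructor
    · intro hx
      exact ⟨_, hx, by simp⟩
    · rintro ⟨y, hy, rfl⟩
      change ![0, 0, y 2, y 3] ∈ S
      rwa [eq_of_planar (hp y hy)]
  rw [h]
  exact hS.image (by fun_prop)

theorem pierceMap_eq_zero_iff {l : Loop} {p : (ℝ × ℝ) × ℝ} :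
    pierceMap l p = 0 ↔ l p.2 1 = 0 ∧ l p.2 2 = p.1.1 ∧ l p.2 3 = p.1.2 := by
  rw [pierceMap, planeL_apply, Prod.ext_iff, Prod.ext_iff]
  simp only [hat, Prod.fst_sub, Prod.snd_sub, Prod.fst_zero, Prod.snd_zero, sub_eq_zero]
  simp
  tauto

theorem proj0_mem_of_pierceMap_eq_zero {l : Loop} {S : Set (Fin 4 → ℝ)} {p : (ℝ × ℝ) × ℝ}
    (hp : p.1 ∈ planeSet S) (h : pierceMap l p = 0) : proj0 (l p.2) ∈ proj0 '' S := by
  obtain ⟨h1, h2, h3⟩ := pierceMap_eq_zero_iff.1 h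
  refine ⟨_, hp, ?_⟩
  ext i; fin_cases i <;> simp [proj0, h1, h2, h3]

theorem exists_pierceMap_eq_zero {l : Loop} {S : Set (Fin 4 → ℝ)}
    (hS : ∀ x ∈ S, x 0 = 0 ∧ x 1 = 0) {s : ℝ} (h : proj0 (l s) ∈ proj0 '' S) :
    (l s 2, l s 3) ∈ planeSet S ∧ pierceMap l ((l s 2, l s 3), s) = 0 := by
  obtain ⟨y, hy, hys⟩ := h
  have h1 : y 1 = l s 1 := congrFun hys 0
  have h2 : y 2 = l s 2 := congrFun hys 1
  have h3 : y 3 = l s 3 := congrFun hys 2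
  refine ⟨?_, pierceMap_eq_zero_iff.2 ⟨by rw [← h1, (hS y hy).2], rfl, rfl⟩⟩
  change ![0, 0, l s 2, l s 3] ∈ S
  rw [← h2, ← h3, eq_of_planar (hS y hy)]
  exact hy

theorem tendsto_pierce_integral {l : Loop} {S : Set (Fin 4 → ℝ)} (hSc : IsCompact S)
    (hS : ∀ x ∈ S, x 0 = 0 ∧ x 1 = 0) (hpierce : PiercesTransversally l S)
    (hinj : ∀ s t, proj0 (l s) = proj0 (l t) → l s = l t)
    {A : Set (ℝ × ℝ)} (hA : MeasurableSet A) (hAS : A ⊆ planeSet S)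
    (hAn : ∀ x ∈ piercings l S, A ∈ 𝓝 (x 1, x 2))
    {w : ℝ → (ℝ × ℝ) × ℝ → ℝ} (hw : ∀ κ, Continuous (w κ)) {C : ℝ} (hwC : ∀ κ p, |w κ p| ≤ C)
    (hwp : ∀ κ x s, w κ (x, s + 1) = w κ (x, s)) {c : ℝ}
    (hwl : ∀ p : (ℝ × ℝ) × ℝ, p.1 ∈ planeSet S → pierceMap l p = 0 →
      Tendsto (fun z : ℝ × (ℝ × ℝ) × ℝ => w z.1 z.2) (atTop ×ˢ 𝓝 p)
        (𝓝 (|deriv l.toFun p.2 1| * c))) :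
    Tendsto (fun κ : ℝ => κ ^ 3 * ∫ x in A, ∫ s in (0 : ℝ)..1,
        w κ (x, s) * Real.exp (-κ ^ 2 * quad3 (pierceMap l (x, s)))) atTop
      (𝓝 (8 * Real.pi * √(8 * Real.pi) * c * (piercings l S).ncard)) := by
  have hTc := isCompact_planeSet hSc hS
  have hne : ∀ p : (ℝ × ℝ) × ℝ, p.1 ∈ planeSet S → pierceMap l p = 0 →
      deriv l.toFun p.2 1 ≠ 0 := fun p hp h0 =>
    hpierce p.2 (proj0_mem_of_pierceMap_eq_zero hp h0)
  have hfin : ∀ a : ℝ, {p ∈ planeSet S ×ˢ Set.Icc a (a + 1) | pierceMap l p = 0}.Finite :=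
    fun a => finite_zeros_of_nondegenerate (continuous_pierceMap l) (hTc.prod isCompact_Icc)
      (fun p _ _ => hasFDerivAt_pierceMap l p)
      (fun p hp h0 => injective_pierceDeriv (hne p hp.1 h0))
  obtain ⟨a, ha, ha'⟩ := ((Set.Ico_infinite (zero_lt_one (α := ℝ))).sdiff
    ((hfin 0).image Prod.snd)).nonempty
  set K : Set ((ℝ × ℝ) × ℝ) := A ×ˢ Set.Icc a (a + 1) with hK
  set K' : Set ((ℝ × ℝ) × ℝ) := planeSet S ×ˢ Set.Icc a (a + 1) with hK'
  have hK'c : IsCompact K' := hTc.prod isCompact_Icc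
  have hKm : MeasurableSet K := hA.prod measurableSet_Icc
  have hKK' : K ⊆ K' := Set.prod_mono hAS subset_rfl
  set Z := (hfin a).toFinset with hZ
  have hZmem : ∀ p, p ∈ Z ↔ p ∈ K' ∧ pierceMap l p = 0 := by
    intro p; rw [hZ, Set.Finite.mem_toFinset]; rfl
  have hfa : Int.fract a = a := Int.fract_eq_self.2 ha
  have hint : ∀ p ∈ Z, p.2 ∈ Set.Ioo a (a + 1) := by
    intro p hp
    obtain ⟨⟨h1, h2⟩, h0⟩ := (hZmem p).1 hp
    have na : Int.fract p.2 ≠ a := by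
      intro h
      refine ha' ⟨(p.1, Int.fract p.2), ⟨⟨h1, ⟨Int.fract_nonneg _, ?_⟩⟩, ?_⟩, h⟩
      · linarith [Int.fract_lt_one p.2]
      · rw [pierceMap_eq_zero_iff] at h0 ⊢
        simpa only [l.apply_fract] using h0
    refine ⟨lt_of_le_of_ne h2.1 ?_, lt_of_le_of_ne h2.2 ?_⟩
    · rintro h; exact na (by rw [← h, hfa])
    · rintro h; exact na (by rw [h, Int.fract_add_one, hfa])
  have hpm : ∀ p ∈ Z, proj0 (l p.2) ∈ piercings l S := fun p hp =>
    ⟨⟨_, ⟨p.2, rfl⟩, rfl⟩,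
      proj0_mem_of_pierceMap_eq_zero ((hZmem p).1 hp).1.1 ((hZmem p).1 hp).2⟩
  have hlim := tendsto_concentration (volume : Measure ((ℝ × ℝ) × ℝ)) isCoerciveQuadratic_quad3
    (continuous_pierceMap l) (K := K) (K' := K') hKm hKK' hK'c Z
    (fun p hp h0 => (hZmem p).2 ⟨hp, h0⟩) (fun p hp => ((hZmem p).1 hp).2)
    (fun p hp => by
      refine prod_mem_nhds ?_ (Icc_mem_nhds (hint p hp).1 (hint p hp).2)
      obtain ⟨-, h2, h3⟩ := pierceMap_eq_zero_iff.1 ((hZmem p).1 hp).2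
      have := hAn _ (hpm p hp)
      simp only [proj0] at this
      have he : ((l p.2 2, l p.2 3) : ℝ × ℝ) = p.1 := Prod.ext h2 h3
      rw [← he]
      exact this)
    (A := fun p => pierceDeriv (deriv l.toFun p.2)) (fun p _ => hasFDerivAt_pierceMap l p)
    (fun p hp => injective_pierceDeriv (hne p ((hZmem p).1 hp).1.1 ((hZmem p).1 hp).2))
    (g := w) hw (C := C) (fun κ p _ => hwC κ p)
    (g₀ := fun p => |deriv l.toFun p.2 1| * c)
    (fun p hp => hwl p ((hZmem p).1 hp).1.1 ((hZmem p).1 hp).2)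
  have hrank : Module.finrank ℝ ((ℝ × ℝ) × ℝ) = 3 := by simp
  rw [hrank] at hlim
  have hper : ∀ κ, ∫ p in K, w κ p * Real.exp (-κ ^ 2 * quad3 (pierceMap l p)) =
      ∫ x in A, ∫ s in (0 : ℝ)..1,
        w κ (x, s) * Real.exp (-κ ^ 2 * quad3 (pierceMap l (x, s))) := by
    intro κ
    have hc : Continuous fun p => w κ p * Real.exp (-κ ^ 2 * quad3 (pierceMap l p)) :=
      (hw κ).mul (Real.continuous_exp.comp (continuous_const.mul
        (isCoerciveQuadratic_quad3.continuous.comp (continuous_pierceMap l))))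
    have hi := (hc.continuousOn.integrableOn_compact (μ := volume) hK'c).mono_set hKK'
    rw [Measure.volume_eq_prod] at hi ⊢
    rw [hK, setIntegral_prod _ hi]
    refine integral_congr_ae (Eventually.of_forall fun x => ?_)
    have hp := Function.Periodic.intervalIntegral_add_eq
      (f := fun s => w κ (x, s) * Real.exp (-κ ^ 2 * quad3 (pierceMap l (x, s)))) (T := 1)
      (fun s => by simp only [hwp, pierceMap, l.periodic s]) 0 a
    rw [zero_add] at hp
    simp only
    rw [hp, intervalIntegral.integral_of_le (by linarith), integral_Icc_eq_integral_Ioc]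
  simp_rw [hper] at hlim
  refine hlim.trans (le_of_eq ?_)
  congr 1
  have hbij : Set.BijOn (fun p : (ℝ × ℝ) × ℝ => proj0 (l p.2)) (Z : Set ((ℝ × ℝ) × ℝ))
      (piercings l S) := by
    refine ⟨hpm, ?_, ?_⟩
    · intro p hp p' hp' h
      have hl := hinj _ _ h
      have hs : p.2 = p'.2 := injOn_fract_Ico a (Set.Ioo_subset_Ico_self (hint p hp))
        (Set.Ioo_subset_Ico_self (hint p' hp')) (l.fract_eq_of_apply_eq hl)
      obtain ⟨-, h2, h3⟩ := pierceMap_eq_zero_iff.1 ((hZmem p).1 hp).2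
      obtain ⟨-, h2', h3'⟩ := pierceMap_eq_zero_iff.1 ((hZmem p').1 hp').2
      refine Prod.ext (Prod.ext ?_ ?_) hs
      · rw [← h2, ← h2', hl]
      · rw [← h3, ← h3', hl]
    · rintro _ ⟨⟨_, ⟨s, rfl⟩, rfl⟩, hs⟩
      obtain ⟨t, ht, hts⟩ := exists_mem_Ico_fract_eq ha
        ⟨Int.fract_nonneg s, Int.fract_lt_one s⟩
      have hlt : l.toFun t = l.toFun s := by rw [← l.apply_fract t, hts, l.apply_fract]
      rw [← hlt] at hs ⊢
      obtain ⟨h1, h2⟩ := exists_pierceMap_eq_zero hS hs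
      exact ⟨_, (hZmem _).2 ⟨⟨h1, Set.Ico_subset_Icc_self ht⟩, h2⟩, rfl⟩
  have hcard : (piercings l S).ncard = Z.card := by
    rw [← hbij.ncard_eq, Set.ncard_coe_finset]
  rw [hcard, mul_comm, ← nsmul_eq_mul, ← Finset.sum_const]
  refine Finset.sum_congr rfl fun p hp => ?_
  have h0 := hne p ((hZmem p).1 hp).1.1 ((hZmem p).1 hp).2
  rw [integral_exp_neg_quad3_pierceDeriv h0]
  have : |deriv l.toFun p.2 1| ≠ 0 := abs_ne_zero.2 h0
  field_simp

theorem Loop.exists_abs_deriv_le (l : Loop) (i : Fin 4) : ∃ C, ∀ s, |deriv l.toFun s i| ≤ C := by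
  have hd : Continuous fun s => deriv l.toFun s i := (continuous_apply i).comp l.continuous_deriv
  obtain ⟨C, hC⟩ := (isCompact_Icc (a := (0 : ℝ)) (b := 1)).exists_bound_of_continuousOn
    hd.continuousOn
  refine ⟨C, fun s => ?_⟩
  rw [← l.deriv_fract]
  exact hC _ ⟨Int.fract_nonneg s, (Int.fract_lt_one s).le⟩

/-- The amplitude of the source of a loop in front of the spatial Gaussian. -/
noncomputable def pierceAmp (l : Loop) (κ s : ℝ) : ℝ :=
  deriv l.toFun s 1 * smear (κ * (0 - l s 0))

/-- The pairing of the source of a loop with the Gaussian centered at the point `x` of the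
`x₂`-`x₃` plane. -/
noncomputable def pierceField (l : Loop) (κ : ℝ) (x : ℝ × ℝ) : ℝ :=
  ∫ s in (0 : ℝ)..1, pierceAmp l κ s * Real.exp (-κ ^ 2 * quad3 (pierceMap l (x, s)))

theorem continuous_pierceAmp (l : Loop) (κ : ℝ) : Continuous (pierceAmp l κ) :=
  ((continuous_apply 1).comp l.continuous_deriv).mul (continuous_smear.comp
    (continuous_const.mul (continuous_const.sub ((continuous_apply 0).comp l.continuous))))

theorem periodic_pierceAmp (l : Loop) (κ s : ℝ) : pierceAmp l κ (s + 1) = pierceAmp l κ s := by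
  simp only [pierceAmp, l.periodic s, l.periodic_deriv s]

theorem exists_abs_pierceAmp_le (l : Loop) : ∃ C, ∀ κ s, |pierceAmp l κ s| ≤ C := by
  obtain ⟨C, hC⟩ := l.exists_abs_deriv_le 1
  refine ⟨C * √(2 * Real.pi), fun κ s => ?_⟩
  rw [pierceAmp, abs_mul]
  exact mul_le_mul (hC s) (abs_smear_le _) (abs_nonneg _) ((abs_nonneg _).trans (hC s))

theorem continuous_pierce_integrand (l : Loop) (κ : ℝ) :
    Continuous fun p : (ℝ × ℝ) × ℝ =>
      pierceAmp l κ p.2 * Real.exp (-κ ^ 2 * quad3 (pierceMap l p)) :=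
  ((continuous_pierceAmp l κ).comp continuous_snd).mul (Real.continuous_exp.comp
    (continuous_const.mul (isCoerciveQuadratic_quad3.continuous.comp (continuous_pierceMap l))))

theorem continuous_pierceField (l : Loop) (κ : ℝ) : Continuous (pierceField l κ) :=
  intervalIntegral.continuous_parametric_intervalIntegral_of_continuous'
    (f := fun x s => pierceAmp l κ s * Real.exp (-κ ^ 2 * quad3 (pierceMap l (x, s))))
    (continuous_pierce_integrand l κ) 0 1

theorem tendsto_pierceAmp (l : Loop) (p : (ℝ × ℝ) × ℝ) (h : l p.2 0 ≠ 0) :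
    Tendsto (fun z : ℝ × (ℝ × ℝ) × ℝ => pierceAmp l z.1 z.2.2) (atTop ×ˢ 𝓝 p)
      (𝓝 (deriv l.toFun p.2 1 * (√(2 * Real.pi) * (SignType.sign (0 - l p.2 0) : ℤ)))) := by
  have hd : Continuous fun p : (ℝ × ℝ) × ℝ => deriv l.toFun p.2 1 :=
    (continuous_apply 1).comp (l.continuous_deriv.comp continuous_snd)
  have h0 : Continuous fun p : (ℝ × ℝ) × ℝ => 0 - l p.2 0 :=
    continuous_const.sub ((continuous_apply 0).comp (l.continuous.comp continuous_snd))
  have t0 : Tendsto (fun z : ℝ × (ℝ × ℝ) × ℝ => deriv l.toFun z.2.2 1) (atTop ×ˢ 𝓝 p)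
    (𝓝 (deriv l.toFun p.2 1)) := (hd.tendsto p).comp tendsto_snd
  exact t0.mul (tendsto_smear_mul (h := fun p : (ℝ × ℝ) × ℝ => 0 - l p.2 0) h0.continuousAt
    (by simpa using h))

theorem abs_sign_eq_one {x : ℝ} (hx : x ≠ 0) : |((SignType.sign x : ℤ) : ℝ)| = 1 := by
  rcases hx.lt_or_gt with h | h
  · rw [sign_neg h]; simp
  · rw [sign_pos h]; simp

theorem self_mul_sign_eq_abs (x : ℝ) : x * ((SignType.sign x : ℤ) : ℝ) = |x| := by
  rcases lt_trichotomy x 0 with h | h | h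
  · rw [sign_neg h, abs_of_neg h]; simp
  · simp [h]
  · rw [sign_pos h, abs_of_pos h]; simp

/-- Prescribed values of modulus at most one on a finite set extend to a continuous function of
modulus at most one. -/
theorem exists_continuous_eqOn_finite {X : Type*} [TopologicalSpace X] [T1Space X] [NormalSpace X]
    {P : Set X} (hP : P.Finite) {ε : X → ℝ} (hε : ∀ x, |ε x| ≤ 1) :
    ∃ θ : X → ℝ, Continuous θ ∧ (∀ x, |θ x| ≤ 1) ∧ ∀ x ∈ P, θ x = ε x := by
  have : Finite P := hP
  obtain ⟨g, hg, hgr⟩ := ContinuousMap.exists_restrict_eq_forall_mem_of_closed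
    (s := P) (⟨fun x => ε x, continuous_of_discreteTopology⟩ : C(P, ℝ)) (t := Set.Icc (-1) 1)
    (fun x => abs_le.1 (hε x)) ⟨0, by norm_num⟩ hP.isClosed
  exact ⟨g, g.continuous, fun x => abs_le.2 (hg x), fun x hx => congrArg (fun f => f ⟨x, hx⟩) hgr⟩

open Classical in
/-- The sign with which some loop of the family passes through the point `x` of the plane. -/
noncomputable def pierceSign {n : ℕ} (L : Fin n → Loop) (x : ℝ × ℝ) : ℝ :=
  if h : ∃ us : Fin n × ℝ, pierceMap (L us.1) (x, us.2) = 0 then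
    ((SignType.sign (deriv (L h.choose.1).toFun h.choose.2 1) : ℤ) : ℝ) *
      ((SignType.sign (0 - L h.choose.1 h.choose.2 0) : ℤ) : ℝ)
  else 0

theorem abs_pierceSign_le {n : ℕ} (L : Fin n → Loop) (x : ℝ × ℝ) : |pierceSign L x| ≤ 1 := by
  have h : ∀ y : ℝ, |((SignType.sign y : ℤ) : ℝ)| ≤ 1 := by
    intro y
    rcases eq_or_ne y 0 with rfl | hy
    · simp
    · rw [abs_sign_eq_one hy]
  unfold pierceSign
  split_ifs
  · rw [abs_mul]
    exact mul_le_one₀ (h _) (abs_nonneg _) (h _)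
  · simp

theorem pierceSign_eq {n : ℕ} {L : Fin n → Loop}
    (hdisj : ∀ u v, u ≠ v → Disjoint (L u).carrier (L v).carrier)
    (hinj : ∀ u v s t, proj0 (L u s) = proj0 (L v t) → L u s = L v t) {u : Fin n}
    {p : (ℝ × ℝ) × ℝ} (hp : pierceMap (L u) p = 0) :
    pierceSign L p.1 = ((SignType.sign (deriv (L u).toFun p.2 1) : ℤ) : ℝ) *
      ((SignType.sign (0 - L u p.2 0) : ℤ) : ℝ) := by
  have h : ∃ us : Fin n × ℝ, pierceMap (L us.1) (p.1, us.2) = 0 := ⟨(u, p.2), hp⟩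
  have hc := h.choose_spec
  rw [pierceSign, dif_pos h]
  generalize h.choose = us at hc
  obtain ⟨v, t⟩ := us
  obtain ⟨h1, h2, h3⟩ := pierceMap_eq_zero_iff.1 hp
  obtain ⟨h1', h2', h3'⟩ := pierceMap_eq_zero_iff.1 hc
  simp only at h1' h2' h3' ⊢
  have hL : L v t = L u p.2 := by
    apply hinj
    ext i
    fin_cases i
    · simp [proj0, h1, h1']
    · simp [proj0, h2, h2']
    · simp [proj0, h3, h3']
  obtain rfl : v = u := by
    by_contra hne
    exact Set.disjoint_left.1 (hdisj v u hne) ⟨t, rfl⟩ ⟨p.2, hL.symm⟩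
  rw [hL, ← (L v).deriv_fract t, (L v).fract_eq_of_apply_eq hL, (L v).deriv_fract]

theorem tendsto_integral_abs_sum_pierceField {n : ℕ} {L : Fin n → Loop} {S : Set (Fin 4 → ℝ)}
    (hdisj : ∀ u v, u ≠ v → Disjoint (L u).carrier (L v).carrier)
    (hinj : ∀ u v s t, proj0 (L u s) = proj0 (L v t) → L u s = L v t)
    (hSc : IsCompact S) (hS : ∀ x ∈ S, x 0 = 0 ∧ x 1 = 0)
    (hLS : ∀ u, Disjoint (L u).carrier S) (hfin : ∀ u, (piercings (L u) S).Finite)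
    (hpierce : ∀ u, PiercesTransversally (L u) S) (Γ : Finset (Fin n))
    {A : Set (ℝ × ℝ)} (hA : MeasurableSet A) (hAS : A ⊆ planeSet S)
    (hAn : ∀ u ∈ Γ, ∀ x ∈ piercings (L u) S, A ∈ 𝓝 (x 1, x 2)) :
    Tendsto (fun κ : ℝ => κ ^ 3 * ∫ x in A, |∑ u ∈ Γ, pierceField (L u) κ x|) atTop
      (𝓝 (∑ u ∈ Γ, 8 * Real.pi * √(8 * Real.pi) * √(2 * Real.pi) *
        (piercings (L u) S).ncard)) := by
  have hTc := isCompact_planeSet hSc hS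
  have htime : ∀ u (p : (ℝ × ℝ) × ℝ), p.1 ∈ planeSet S → pierceMap (L u) p = 0 →
      L u p.2 0 ≠ 0 := by
    intro u p hp h0 ht
    obtain ⟨h1, h2, h3⟩ := pierceMap_eq_zero_iff.1 h0
    refine Set.disjoint_left.1 (hLS u) ⟨p.2, rfl⟩ ?_
    have : (L u) p.2 = ![0, 0, p.1.1, p.1.2] := by
      ext i; fin_cases i <;> simp [ht, h1, h2, h3]
    rw [this]; exact hp
  have hPfin : (⋃ u, (fun x : Fin 3 → ℝ => ((x 1, x 2) : ℝ × ℝ)) '' piercings (L u) S).Finite :=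
    Set.finite_iUnion fun u => (hfin u).image _
  obtain ⟨θ, hθc, hθ1, hθP⟩ := exists_continuous_eqOn_finite hPfin (abs_pierceSign_le L)
  have hθ : ∀ u (p : (ℝ × ℝ) × ℝ), p.1 ∈ planeSet S → pierceMap (L u) p = 0 → θ p.1 =
      ((SignType.sign (deriv (L u).toFun p.2 1) : ℤ) : ℝ) *
        ((SignType.sign (0 - L u p.2 0) : ℤ) : ℝ) := by
    intro u p hp h0
    rw [← pierceSign_eq hdisj hinj h0]
    refine hθP _ (Set.mem_iUnion.2 ⟨u, proj0 (L u p.2), ⟨⟨_, ⟨p.2, rfl⟩, rfl⟩,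
      proj0_mem_of_pierceMap_eq_zero hp h0⟩, ?_⟩)
    obtain ⟨-, h2, h3⟩ := pierceMap_eq_zero_iff.1 h0
    exact Prod.ext h2 h3
  have hupper : ∀ u ∈ Γ, Tendsto (fun κ : ℝ => κ ^ 3 * ∫ x in A, ∫ s in (0 : ℝ)..1,
      |pierceAmp (L u) κ s| * Real.exp (-κ ^ 2 * quad3 (pierceMap (L u) (x, s)))) atTop
      (𝓝 (8 * Real.pi * √(8 * Real.pi) * √(2 * Real.pi) * (piercings (L u) S).ncard)) := by
    intro u hu
    obtain ⟨C, hC⟩ := exists_abs_pierceAmp_le (L u)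
    refine tendsto_pierce_integral hSc hS (hpierce u) (hinj u u) hA hAS (hAn u hu)
      (w := fun κ p => |pierceAmp (L u) κ p.2|) (C := C)
      (fun κ => ((continuous_pierceAmp (L u) κ).comp continuous_snd).abs)
      (fun κ p => by rw [abs_abs]; exact hC κ p.2)
      (fun κ x s => by simp only [periodic_pierceAmp]) ?_
    intro p hp h0
    have ht := htime u p hp h0
    have := (tendsto_pierceAmp (L u) p ht).abs
    rwa [abs_mul, abs_mul, abs_sign_eq_one (by simpa using ht), mul_one,
      abs_of_nonneg (Real.sqrt_nonneg _)] at this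
  have hlower : ∀ u ∈ Γ, Tendsto (fun κ : ℝ => κ ^ 3 * ∫ x in A, ∫ s in (0 : ℝ)..1,
      θ x * pierceAmp (L u) κ s * Real.exp (-κ ^ 2 * quad3 (pierceMap (L u) (x, s)))) atTop
      (𝓝 (8 * Real.pi * √(8 * Real.pi) * √(2 * Real.pi) * (piercings (L u) S).ncard)) := by
    intro u hu
    obtain ⟨C, hC⟩ := exists_abs_pierceAmp_le (L u)
    refine tendsto_pierce_integral hSc hS (hpierce u) (hinj u u) hA hAS (hAn u hu)
      (w := fun κ p => θ p.1 * pierceAmp (L u) κ p.2) (C := C)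
      (fun κ => (hθc.comp continuous_fst).mul
        ((continuous_pierceAmp (L u) κ).comp continuous_snd))
      (fun κ p => by
        rw [abs_mul]
        nlinarith [hθ1 p.1, hC κ p.2, abs_nonneg (θ p.1), abs_nonneg (pierceAmp (L u) κ p.2)])
      (fun κ x s => by simp only [periodic_pierceAmp]) ?_
    intro p hp h0
    have ht := htime u p hp h0
    have t1 : Tendsto (fun z : ℝ × (ℝ × ℝ) × ℝ => θ z.2.1) (atTop ×ˢ 𝓝 p) (𝓝 (θ p.1)) :=
      ((hθc.comp continuous_fst).tendsto p).comp tendsto_snd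
    refine (t1.mul (tendsto_pierceAmp (L u) p ht)).trans (le_of_eq ?_)
    congr 1
    have hs : ((SignType.sign (0 - L u p.2 0) : ℤ) : ℝ) *
        ((SignType.sign (0 - L u p.2 0) : ℤ) : ℝ) = 1 := by
      rw [← abs_mul_abs_self, abs_sign_eq_one (by simpa using ht), one_mul]
    rw [hθ u p hp h0, ← self_mul_sign_eq_abs (deriv (L u).toFun p.2 1)]
    linear_combination (deriv (L u).toFun p.2 1 *
      ((SignType.sign (deriv (L u).toFun p.2 1) : ℤ) : ℝ) * √(2 * Real.pi)) * hs
  have hpoint : ∀ κ u x, |pierceField (L u) κ x| ≤ ∫ s in (0 : ℝ)..1,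
      |pierceAmp (L u) κ s| * Real.exp (-κ ^ 2 * quad3 (pierceMap (L u) (x, s))) := by
    intro κ u x
    refine (intervalIntegral.abs_integral_le_integral_abs zero_le_one).trans (le_of_eq ?_)
    simp_rw [abs_mul, Real.abs_exp]
  have hupc : ∀ κ u, Continuous fun x => ∫ s in (0 : ℝ)..1,
      |pierceAmp (L u) κ s| * Real.exp (-κ ^ 2 * quad3 (pierceMap (L u) (x, s))) := by
    intro κ u
    refine intervalIntegral.continuous_parametric_intervalIntegral_of_continuous'
      (f := fun x s => |pierceAmp (L u) κ s| *
        Real.exp (-κ ^ 2 * quad3 (pierceMap (L u) (x, s)))) ?_ 0 1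
    exact (((continuous_pierceAmp (L u) κ).comp continuous_snd).abs).mul (Real.continuous_exp.comp
      (continuous_const.mul (isCoerciveQuadratic_quad3.continuous.comp
        (continuous_pierceMap (L u)))))
  have hon : ∀ f : ℝ × ℝ → ℝ, Continuous f → IntegrableOn f A := fun f hf =>
    (hf.continuousOn.integrableOn_compact hTc).mono_set hAS
  refine tendsto_of_tendsto_of_tendsto_of_le_of_le' (tendsto_finsetSum Γ hlower)
    (tendsto_finsetSum Γ hupper) ?_ ?_
  · filter_upwards [eventually_ge_atTop 0] with κ hκ
    rw [← Finset.mul_sum]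
    refine mul_le_mul_of_nonneg_left ?_ (by positivity)
    have he : ∀ u x, ∫ s in (0 : ℝ)..1, θ x * pierceAmp (L u) κ s *
        Real.exp (-κ ^ 2 * quad3 (pierceMap (L u) (x, s))) = θ x * pierceField (L u) κ x := by
      intro u x
      simp_rw [mul_assoc]
      rw [intervalIntegral.integral_const_mul]
      rfl
    simp_rw [he]
    have hθi : ∀ u ∈ Γ, IntegrableOn (fun x => θ x * pierceField (L u) κ x) A := fun u _ =>
      hon _ (hθc.mul (continuous_pierceField (L u) κ))
    rw [← integral_finsetSum Γ hθi]
    refine setIntegral_mono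
      (hon _ (continuous_finsetSum Γ fun u _ => hθc.mul (continuous_pierceField (L u) κ)))
      (hon _ (continuous_finsetSum Γ fun u _ => continuous_pierceField (L u) κ).abs) fun x => ?_
    simp only
    rw [← Finset.mul_sum]
    refine (le_abs_self _).trans ?_
    rw [abs_mul]
    exact mul_le_of_le_one_left (abs_nonneg _) (hθ1 x)
  · filter_upwards [eventually_ge_atTop 0] with κ hκ
    rw [← Finset.mul_sum]
    refine mul_le_mul_of_nonneg_left ?_ (by positivity)
    rw [← integral_finsetSum Γ fun u _ => hon _ (hupc κ u)]
    refine setIntegral_mono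
      (hon _ (continuous_finsetSum Γ fun u _ => continuous_pierceField (L u) κ).abs)
      (hon _ (continuous_finsetSum Γ fun u _ => hupc κ u)) fun x => ?_
    exact (Finset.abs_sum_le_sum_abs _ _).trans (Finset.sum_le_sum fun u _ => hpoint κ u x)

/-! ### Change of variables on the surface -/

theorem Parametrizes.exists_change_of_variables {σ : ℝ × ℝ → Fin 4 → ℝ} {S : Set (Fin 4 → ℝ)}
    (hσ : Parametrizes σ S) {J : Set (ℝ × ℝ)} (hJ : MeasurableSet J) (hJs : J ⊆ unitSquare) :
    ∃ A : Set (ℝ × ℝ), MeasurableSet A ∧ A ⊆ planeSet S ∧ planeInterior (σ '' J) ⊆ A ∧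
      ∀ h : ℝ × ℝ → ℝ, ∫ t in J, h (σ t 2, σ t 3) * jac σ 2 3 t = ∫ x in A, h x := by
  obtain ⟨U, hUo, hUs, hU0, hU1, hUc, hUi, hUj⟩ := hσ.regular
  set f : ℝ × ℝ → ℝ × ℝ := fun t => (σ t 2, σ t 3) with hf
  set P : (Fin 4 → ℝ) →L[ℝ] ℝ × ℝ := (ContinuousLinearMap.proj (R := ℝ)
    (φ := fun _ : Fin 4 => ℝ) 2).prod (ContinuousLinearMap.proj 3) with hP
  have hmem : ∀ t ∈ unitSquare, σ t ∈ S := fun t ht => hσ.image_eq ▸ ⟨t, ht, rfl⟩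
  have hpl : ∀ t ∈ unitSquare, ![0, 0, σ t 2, σ t 3] = σ t := fun t ht =>
    eq_of_planar (hσ.planar _ (hmem t ht))
  have hfd : ∀ t ∈ J ∩ U, HasFDerivWithinAt f (P.comp (fderiv ℝ σ t)) (J ∩ U) t := by
    intro t ht
    have h1 : DifferentiableAt ℝ σ t :=
      (hUc.differentiableOn one_ne_zero).differentiableAt (hUo.mem_nhds ht.2)
    exact (P.hasFDerivAt.comp t h1.hasFDerivAt).hasFDerivWithinAt
  have hfi : Set.InjOn f (J ∩ U) := by
    intro s hs t ht hst
    obtain ⟨h2, h3⟩ := Prod.mk.inj hst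
    refine hUi hs.2 ht.2 ?_
    rw [← hpl s (hUs hs.2), ← hpl t (hUs ht.2), h2, h3]
  have hm : MeasurableSet (J ∩ U) := hJ.inter hUo.measurableSet
  have himg : MeasurableSet (f '' (J ∩ U)) := measurable_image_of_fderivWithin hm hfd hfi
  have hsub : planeSet (σ '' J) ⊆ f '' J := by
    rintro x ⟨t, ht, htx⟩
    exact ⟨t, ht, by simp [hf, htx]⟩
  have hdiff : planeInterior (σ '' J) \ f '' (J ∩ U) ⊆ f '' (unitSquare \ U) := by
    rintro x ⟨hx, hxn⟩
    obtain ⟨t, ht, rfl⟩ := hsub (interior_subset hx)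
    exact ⟨t, ⟨hJs ht, fun htU => hxn ⟨t, ⟨ht, htU⟩, rfl⟩⟩, rfl⟩
  refine ⟨f '' (J ∩ U) ∪ planeInterior (σ '' J), himg.union isOpen_interior.measurableSet, ?_,
    Set.subset_union_right, fun h => ?_⟩
  · rintro x (⟨t, ht, rfl⟩ | hx)
    · change ![0, 0, σ t 2, σ t 3] ∈ S
      rw [hpl t (hJs ht.1)]
      exact hmem t (hJs ht.1)
    · obtain ⟨t, ht, htx⟩ := interior_subset hx
      change ![0, 0, x.1, x.2] ∈ S
      rw [← htx]
      exact hmem t (hJs ht)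
  · have hnull : (f '' (J ∩ U) ∪ planeInterior (σ '' J) : Set (ℝ × ℝ)) =ᵐ[volume]
        f '' (J ∩ U) := by
      rw [← Set.union_sdiff_self]
      exact union_ae_eq_left_of_ae_eq_empty
        (ae_eq_empty.2 (measure_mono_null hdiff hU1))
    have hJU : (J : Set (ℝ × ℝ)) =ᵐ[volume] (J ∩ U : Set (ℝ × ℝ)) := by
      have h0 : volume (J \ U) = 0 := measure_mono_null (Set.sdiff_subset_sdiff_left hJs) hU0
      conv_lhs => rw [← Set.inter_union_sdiff J U]
      exact union_ae_eq_left_of_ae_eq_empty (ae_eq_empty.2 h0)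
    rw [setIntegral_congr_set hJU, setIntegral_congr_set hnull,
      integral_image_eq_integral_abs_det_fderiv_smul volume hm hfd hfi]
    refine setIntegral_congr_fun hm fun t ht => ?_
    have hdet : (P.comp (fderiv ℝ σ t)).det = jac σ 2 3 t := by
      rw [det_eq_two]; rfl
    rw [hdet, abs_of_pos (hUj t ht.2), smul_eq_mul, mul_comm]

/-! ### The limit of the area bracket -/

theorem pair_source_eq_pierceField {n : ℕ} (q : ℝ) {κ : ℝ} (hκ : 0 < κ) (L : Fin n → Loop)
    (Γ : Finset (Fin n)) {y : Fin 4 → ℝ} (hy : y 0 = 0 ∧ y 1 = 0) :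
    pair (source q κ L Γ) (pG κ y) = q * ∑ u ∈ Γ, pierceField (L u) κ (y 2, y 3) := by
  rw [pair_source q hκ]
  unfold pierceField pierceAmp
  simp_rw [← mul_assoc, hy.1]
  congr 1
  refine Finset.sum_congr rfl fun u _ => ?_
  congr 1
  funext s
  congr 3
  rw [quad3, quad2, pierceMap, planeL_apply]
  simp only [Fin.sum_univ_three, hat, Prod.fst_sub, Prod.snd_sub]
  simp [hy.2]
  ring

theorem kbar_const : 8 * Real.pi * √(8 * Real.pi) * √(2 * Real.pi) / (2 * √(4 * Real.pi)) ^ 3 =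
    √Real.pi / 2 := by
  have h8 : √(8 * Real.pi) * √(2 * Real.pi) = 4 * Real.pi := by
    rw [← Real.sqrt_mul (by positivity),
      show 8 * Real.pi * (2 * Real.pi) = (4 * Real.pi) ^ 2 by ring,
      Real.sqrt_sq (by positivity)]
  have h4 : √(4 * Real.pi) = 2 * √Real.pi := by
    rw [Real.sqrt_mul (by norm_num), show (4 : ℝ) = 2 ^ 2 by norm_num, Real.sqrt_sq (by norm_num)]
  have hp : √Real.pi * √Real.pi = Real.pi := Real.mul_self_sqrt Real.pi_pos.le
  have hs : √Real.pi ≠ 0 := by positivity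
  rw [mul_assoc, h8, h4]
  rw [div_eq_div_iff (by positivity) (by norm_num)]
  calc _ = 64 * (Real.pi * Real.pi) := by ring
    _ = 64 * ((√Real.pi * √Real.pi) * (√Real.pi * √Real.pi)) := by rw [hp]
    _ = _ := by ring

theorem tendsto_areaBracket {n m : ℕ} (q : ℝ) {L : Fin n → Loop} (ρ : Fin n → Color)
    {S : Set (Fin 4 → ℝ)}
    (hdisj : ∀ u v, u ≠ v → Disjoint (L u).carrier (L v).carrier)
    (hinj : ∀ u v s t, proj0 (L u s) = proj0 (L v t) → L u s = L v t)
    (hSc : IsCompact S) {σ : ℝ × ℝ → Fin 4 → ℝ} (hσ : Parametrizes σ S)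
    (hLS : ∀ u, Disjoint (L u).carrier S) (hfin : ∀ u, (piercings (L u) S).Finite)
    (hpierce : ∀ u, PiercesTransversally (L u) S)
    (γ : Fin m → Color) (c : Color → SU2Irrep)
    {Iv : Fin m → Set (ℝ × ℝ)} (hIv : IsAdaptedPartition L ρ γ σ S Iv) :
    Tendsto (fun κ : ℝ => areaBracket q κ L ρ γ c σ Iv) atTop
      (𝓝 (|q| * √Real.pi / 2 *
        ∑ v, ∑ u ∈ Gam ρ γ v, ((piercings (L u) S).ncard : ℝ) * √(c (γ v)).xi)) := by
  rw [Finset.mul_sum]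
  unfold areaBracket
  refine tendsto_finsetSum _ fun v _ => ?_
  have hsub : Iv v ⊆ unitSquare := hIv.cover ▸ Set.subset_iUnion Iv v
  obtain ⟨A, hAm, hAS, hAi, hAint⟩ := hσ.exists_change_of_variables (hIv.measurable v) hsub
  have hlim := tendsto_integral_abs_sum_pierceField hdisj hinj hSc hσ.planar hLS hfin hpierce
    (Gam ρ γ v) hAm hAS
    (fun u hu x hx => mem_of_superset (isOpen_interior.mem_nhds (hIv.pierce v u hu x hx)) hAi)
  have h2 := hlim.const_mul (|q| * √(c (γ v)).xi / (2 * √(4 * Real.pi)) ^ 3)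
  have heq : |q| * √(c (γ v)).xi / (2 * √(4 * Real.pi)) ^ 3 *
      ∑ u ∈ Gam ρ γ v, 8 * Real.pi * √(8 * Real.pi) * √(2 * Real.pi) *
        ((piercings (L u) S).ncard : ℝ) = |q| * √Real.pi / 2 *
        ∑ u ∈ Gam ρ γ v, ((piercings (L u) S).ncard : ℝ) * √(c (γ v)).xi := by
    rw [← Finset.mul_sum, ← Finset.sum_mul, mul_div_assoc _ √Real.pi, ← kbar_const]
    ring
  rw [heq] at h2
  refine h2.congr' ?_
  filter_upwards [eventually_gt_atTop 0] with κ hκ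
  have hint : ∫ t in Iv v, |pair (source q κ L (Gam ρ γ v)) (pG κ (σ t)) * √(c (γ v)).xi| *
      jac σ 2 3 t = |q| * √(c (γ v)).xi *
        ∫ x in A, |∑ u ∈ Gam ρ γ v, pierceField (L u) κ x| := by
    rw [← integral_const_mul, ← hAint]
    refine setIntegral_congr_fun (hIv.measurable v) fun t ht => ?_
    have hmem : σ t ∈ S := hσ.image_eq ▸ ⟨t, hsub ht, rfl⟩
    rw [pair_source_eq_pierceField q hκ L _ (hσ.planar _ hmem), abs_mul, abs_mul,
      abs_of_nonneg (Real.sqrt_nonneg _)]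
    ring
  rw [hint, kbar, div_pow]
  ring

/-! ### Representations and colors -/

open scoped Matrix.Norms.Operator in
theorem SU2Irrep.continuous_trExp (ρ : SU2Irrep) : Continuous ρ.trExp := by
  have h : Continuous (NormedSpace.exp :
      Matrix (Fin ρ.dim) (Fin ρ.dim) ℂ → Matrix (Fin ρ.dim) (Fin ρ.dim) ℂ) := by
    exact NormedSpace.exp_continuous
  have h2 : Continuous fun a : ℂ => a • ρ.toHom calE := continuous_id.smul continuous_const
  exact (h.comp h2).matrix_trace

theorem SU2Irrep.Equivalent.symm {ρ τ : SU2Irrep} (h : ρ.Equivalent τ) : τ.Equivalent ρ := by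
  obtain ⟨f, hf⟩ := h
  refine ⟨f.symm, fun X w => ?_⟩
  rw [LinearEquiv.symm_apply_eq, hf, LinearEquiv.apply_symm_apply]

theorem SU2Irrep.Equivalent.trans {ρ τ υ : SU2Irrep} (h : ρ.Equivalent τ) (h' : τ.Equivalent υ) :
    ρ.Equivalent υ := by
  obtain ⟨f, hf⟩ := h
  obtain ⟨g, hg⟩ := h'
  exact ⟨f.trans g, fun X w => by simp [hf, hg]⟩

theorem SU2Irrep.Equivalent.xi_eq {ρ τ : SU2Irrep} (h : ρ.Equivalent τ) : ρ.xi = τ.xi := by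
  obtain ⟨f, -⟩ := h
  have hd : ρ.dim = τ.dim := by simpa using f.finrank_eq
  simp only [SU2Irrep.xi, SU2Irrep.spin, hd]

theorem Color.Same.unique {m n : ℕ} {γ : Fin m → Color} {ρ : Fin n → Color}
    (hγ : ListsDistinct γ ρ) {u : Fin n} {v w : Fin m} (hv : (ρ u).Same (γ v))
    (hw : (ρ u).Same (γ w)) : v = w := by
  by_contra hne
  exact hγ.2.2 v w hne ⟨hv.1.symm.trans hw.1, hv.2.symm.trans hw.2⟩

theorem sum_Gam_eq_momentum {m n : ℕ} {γ : Fin m → Color} {ρ : Fin n → Color}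
    (hγ : ListsDistinct γ ρ) (L : Fin n → Loop) (S : Set (Fin 4 → ℝ)) {c : Color → SU2Irrep}
    (hc : ∀ σ τ : Color, σ.Same τ → (c σ).xi = (c τ).xi) :
    ∑ v, ∑ u ∈ Gam ρ γ v, ((piercings (L u) S).ncard : ℝ) * √(c (γ v)).xi =
      momentum L ρ c S := by
  classical
  unfold momentum Gam
  simp_rw [Finset.sum_filter]
  rw [Finset.sum_comm]
  refine Finset.sum_congr rfl fun u _ => ?_
  obtain ⟨v, hv⟩ := hγ.1 u
  rw [Finset.sum_eq_single v]
  · rw [if_pos hv, hc _ _ hv]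
  · intro w _ hw
    rw [if_neg fun h => hw (Color.Same.unique hγ h hv)]
  · simp

/-! ### Complex powers -/

theorem mul_cpow_of_nonneg {r : ℝ} (hr : 0 ≤ r) (z : ℂ) {w : ℂ} (hw : w ≠ 0) :
    ((r : ℂ) * z) ^ w = (r : ℂ) ^ w * z ^ w := by
  rcases hr.eq_or_lt with rfl | hr
  · simp [hw]
  rcases eq_or_ne z 0 with rfl | hz
  · simp [hw]
  have hr' : (r : ℂ) ≠ 0 := by exact_mod_cast hr.ne'
  rw [Complex.cpow_def_of_ne_zero (mul_ne_zero hr' hz), Complex.cpow_def_of_ne_zero hr',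
    Complex.cpow_def_of_ne_zero hz, Complex.log_ofReal_mul hr hz, ← Complex.ofReal_log hr.le,
    add_mul, Complex.exp_add]

theorem tendsto_I_mul_cpow {α : Type*} {l : Filter α} {f : α → ℝ} {b : ℝ} (hb : 0 ≤ b)
    (hf : Tendsto f l (𝓝 b)) {w : ℂ} (hw : 0 < w.re) :
    Tendsto (fun x => (Complex.I * (f x : ℂ)) ^ w) l (𝓝 ((Complex.I * (b : ℂ)) ^ w)) := by
  have hI : Tendsto (fun x => Complex.I * (f x : ℂ)) l (𝓝 (Complex.I * (b : ℂ))) :=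
    ((Complex.continuous_ofReal.tendsto b).comp hf).const_mul _
  rcases hb.eq_or_lt with rfl | hb
  · have h0 := Complex.continuousAt_cpow_zero_of_re_pos hw
    rw [Complex.ofReal_zero, mul_zero] at hI ⊢
    exact h0.tendsto.comp (hI.prodMk_nhds tendsto_const_nhds)
  · have hs : Complex.I * (b : ℂ) ∈ Complex.slitPlane := by
      right; simpa using hb.ne'
    exact hI.cpow tendsto_const_nhds hs

/-! ### Hyperlinks -/

theorem IsTimeLike.eq_of_proj0_eq {Λ : Set (Fin 4 → ℝ)} (h : IsTimeLike Λ) {p q : Fin 4 → ℝ}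
    (hp : p ∈ Λ) (hq : q ∈ Λ) (hpq : proj0 p = proj0 q) : p = q := by
  by_contra hne
  have := (h p hp q hq hne).1
  have h0 : ∀ i : Fin 3, p i.succ = q i.succ := fun i => congrFun hpq i
  simp [h0] at this

theorem IsTimeLike.separated {Λ : Set (Fin 4 → ℝ)} (h : IsTimeLike Λ) {p q : Fin 4 → ℝ}
    (hp : p ∈ Λ) (hq : q ∈ Λ) (hne : p ≠ q) {k : Fin 3} (hk : hat k p = hat k q) :
    p k.succ - q k.succ ≠ 0 ∧ q 0 - p 0 ≠ 0 := by
  obtain ⟨h1, h2⟩ := h p hp q hq hne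
  have hk0 := congrFun hk 0
  have hk1 := congrFun hk 1
  rw [Fin.sum_univ_three] at h1
  constructor
  · intro h0
    refine hne (h.eq_of_proj0_eq hp hq ?_)
    rw [sub_eq_zero] at h0
    ext i
    fin_cases k <;> fin_cases i <;> simp_all [hat, proj0]
  · intro h0
    refine h2 ?_ (by linarith)
    fin_cases k
    · exact ⟨1, 2, by decide, hk0, hk1⟩
    · exact ⟨0, 2, by decide, hk0, hk1⟩
    · exact ⟨0, 1, by decide, hk0, hk1⟩

theorem tendsto_holExponent {r : ℕ} (q : ℝ) (l : Loop) (G : Fin r → Loop)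
    (hcross : ∀ v, CrossTransversally l (G v))
    (hsep : ∀ v k s t, hat k (l s) = hat k (G v t) →
      l s k.succ - G v t k.succ ≠ 0 ∧ G v t 0 - l s 0 ≠ 0) :
    Tendsto (fun κ : ℝ => holExponent q κ l G) atTop
      (𝓝 (Real.pi * Complex.I * q * skTotal l G)) := by
  have h := (tendsto_finsetSum Finset.univ fun v (_ : v ∈ Finset.univ) =>
    tendsto_linkIntegral l (G v) (hcross v) (hsep v)).const_mul (1 / (4 * Real.pi))
  have h1 := ((Complex.continuous_ofReal.tendsto _).comp h).const_mul (Complex.I * q / 4)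
  have he : Complex.I * q / 4 * ((1 / (4 * Real.pi) *
      ∑ v, 16 * Real.pi ^ 2 * (sk l (G v) : ℝ) : ℝ) : ℂ) =
      Real.pi * Complex.I * q * skTotal l G := by
    rw [← Finset.mul_sum, skTotal]
    have : (Real.pi : ℂ) ≠ 0 := by exact_mod_cast Real.pi_ne_zero
    push_cast
    field_simp
    ring
  rw [he] at h1
  refine h1.congr fun κ => ?_
  simp only [Function.comp_apply, holExponent]
  rw [← Finset.mul_sum]
  congr 2
  ring

end AreaLQG

theorem theorem5p3 {n r m : ℕ} (hn : 0 < n) (q : ℝ)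
    (L : Fin n → Loop) (G : Fin r → Loop) (ρ : Fin n → Color)
    (hLG : IsTimeLikeHyperlink (Sum.elim L G))
    (hcross : ∀ u v, CrossTransversally (L u) (G v))
    (S : Set (Fin 4 → ℝ)) (hS : IsCompact S)
    (σ : ℝ × ℝ → Fin 4 → ℝ) (hσ : Parametrizes σ S)
    (hdisj : ∀ u, Disjoint (L u).carrier S)
    (hfin : ∀ u, (piercings (L u) S).Finite)
    (hpierce : ∀ u, PiercesTransversally (L u) S)
    (γ : Fin m → Color) (hγ : ListsDistinct γ ρ)
    (Iv : Fin m → Set (ℝ × ℝ)) (hIv : IsAdaptedPartition L ρ γ σ S Iv) :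
    Tendsto (fun κ : ℝ => areaExpression q κ L G ρ γ σ Iv) atTop
      (𝓝 (((|q| * √Real.pi / 2 : ℝ) : ℂ) *
        ∏ w, ((momentum L ρ Color.plus S : ℂ) ^ (1 / n : ℂ) *
            (ρ w).plus.trExp (-(Real.pi * Complex.I * q * skTotal (L w) G)) +
          (Complex.I * (momentum L ρ Color.minus S : ℂ)) ^ (1 / n : ℂ) *
            (ρ w).minus.trExp (Real.pi * Complex.I * q * skTotal (L w) G)))) := by
  obtain ⟨hd, htl⟩ := hLG
  have hmem : ∀ i s, (Sum.elim L G i) s ∈ ⋃ i, (Sum.elim L G i).carrier := fun i s =>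
    Set.mem_iUnion.2 ⟨i, s, rfl⟩
  have hLd : ∀ u v, u ≠ v → Disjoint (L u).carrier (L v).carrier := fun u v huv =>
    hd (Sum.inl u) (Sum.inl v) (fun h => huv (Sum.inl.inj h))
  have hinj : ∀ u v s t, proj0 (L u s) = proj0 (L v t) → L u s = L v t := fun u v s t h =>
    htl.eq_of_proj0_eq (hmem (Sum.inl u) s) (hmem (Sum.inl v) t) h
  have hsep : ∀ u v k s t, hat k (L u s) = hat k (G v t) →
      L u s k.succ - G v t k.succ ≠ 0 ∧ G v t 0 - L u s 0 ≠ 0 := by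
    intro u v k s t h
    refine htl.separated (hmem (Sum.inl u) s) (hmem (Sum.inr v) t) ?_ h
    intro he
    exact Set.disjoint_left.1 (hd (Sum.inl u) (Sum.inr v) (by simp)) ⟨s, rfl⟩ ⟨t, he.symm⟩
  have hn0 : (n : ℂ) ≠ 0 := by exact_mod_cast hn.ne'
  have hwne : (1 / n : ℂ) ≠ 0 := one_div_ne_zero hn0
  have hwre : 0 < (1 / n : ℂ).re := by
    have h1 : (1 / n : ℂ) = ((1 / n : ℝ) : ℂ) := by push_cast; rfl
    rw [h1, Complex.ofReal_re]
    positivity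
  set c : ℝ := |q| * √Real.pi / 2 with hc
  have hc0 : 0 ≤ c := by positivity
  have hM0 : ∀ κ : Color → SU2Irrep, 0 ≤ momentum L ρ κ S := fun κ =>
    Finset.sum_nonneg fun u _ => by positivity
  have hbr : ∀ κ : Color → SU2Irrep, (∀ σ τ : Color, σ.Same τ → (κ σ).xi = (κ τ).xi) →
      Tendsto (fun x : ℝ => areaBracket q x L ρ γ κ σ Iv) atTop (𝓝 (c * momentum L ρ κ S)) := by
    intro κ hκ
    have := tendsto_areaBracket q ρ hLd hinj hS hσ hdisj hfin hpierce γ κ hIv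
    rwa [sum_Gam_eq_momentum hγ L S hκ] at this
  have hplus := hbr Color.plus fun _ _ h => h.1.xi_eq
  have hminus := hbr Color.minus fun _ _ h => h.2.xi_eq
  have hpc := ((Complex.continuous_ofReal_cpow_const hwre).tendsto _).comp hplus
  have hmc := tendsto_I_mul_cpow (mul_nonneg hc0 (hM0 Color.minus)) hminus hwre
  have hlim : Tendsto (fun κ : ℝ => areaExpression q κ L G ρ γ σ Iv) atTop
      (𝓝 (∏ w, (((c * momentum L ρ Color.plus S : ℝ) : ℂ) ^ (1 / n : ℂ) *
            (ρ w).plus.trExp (-(Real.pi * Complex.I * q * skTotal (L w) G)) +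
          (Complex.I * ((c * momentum L ρ Color.minus S : ℝ) : ℂ)) ^ (1 / n : ℂ) *
            (ρ w).minus.trExp (Real.pi * Complex.I * q * skTotal (L w) G)))) := by
    refine tendsto_finsetProd _ fun w _ => ?_
    have hh := tendsto_holExponent q (L w) G (hcross w) (hsep w)
    exact (hpc.mul (((ρ w).plus.continuous_trExp.tendsto _).comp hh.neg)).add
      (hmc.mul (((ρ w).minus.continuous_trExp.tendsto _).comp hh))
  refine hlim.trans (le_of_eq ?_)
  congr 1
  have hcn : ∏ _w : Fin n, (c : ℂ) ^ (1 / n : ℂ) = c := by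
    rw [Finset.prod_const, Finset.card_univ, Fintype.card_fin, one_div,
      Complex.cpow_nat_inv_pow _ hn.ne']
  rw [← hcn, ← Finset.prod_mul_distrib]
  refine Finset.prod_congr rfl fun w _ => ?_
  rw [Complex.ofReal_mul, Complex.ofReal_mul, mul_left_comm Complex.I,
    mul_cpow_of_nonneg hc0 _ hwne, mul_cpow_of_nonneg hc0 _ hwne]
  ring
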